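/- A \emph{$k$-span weakly level planar ($k$-SWLP) drawing} of a graph $G$ is a planar straight-line drawing of $G$ whose vertices lie on a set of equispaced horizontal lines, called levels, and in which every edge (a straight-line segment) intersects at most $k+1$ levels. A \emph{Halin graph} is a finite $3$-connected simple graph $G$ with a planar embedding such that removing the edges incident to the outer face yields a tree whose internal vertices have degree at least $3$ (in the tree) and whose leaves are incident to the outer face of $G$. \textbf{Lemma.} Every Halin graph that is not (isomorphic to) $K_4$ has a $1$-SWLP drawing. -/

import Mathlib

namespace SimpleGraph

variable {V : Type*}

/-- A graph is `k`-connected if it has more than `k` vertices and deleting fewer than `k`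
vertices never disconnects it. -/
def IsKConnected (G : SimpleGraph V) (k : ℕ) : Prop :=
  k < Nat.card V ∧ ∀ S : Finset V, S.card < k → (G.induce {v | v ∉ S}).Connected

/-- The permutation of the darts (oriented edges) that reverses every dart. -/
def dartSymmPerm (G : SimpleGraph V) : Equiv.Perm G.Dart where
  toFun := Dart.symm
  invFun := Dart.symm
  left_inv := Dart.symm_symm
  right_inv := Dart.symm_symm

/-- A rotation system on `G`: for every vertex `v`, a cyclic order of the edges around `v`.
The permutation `rot` sends a dart leaving `v` to the next dart leaving `v`, and acts on the darts
leaving `v` as one cycle. -/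
structure RotationSystem (G : SimpleGraph V) where
  rot : Equiv.Perm G.Dart
  rot_fst : ∀ d, (rot d).fst = d.fst
  rot_cyclic : ∀ d d' : G.Dart, d.fst = d'.fst → rot.SameCycle d d'

namespace RotationSystem

variable {G : SimpleGraph V} (R : RotationSystem G)

/-- The face-tracing permutation: after traversing the dart `d` from `u` to `v`, continue with the
dart that follows `d.symm` in the cyclic order around `v`. -/
def facePerm : Equiv.Perm G.Dart := R.rot * G.dartSymmPerm

/-- The faces (given by their closed boundary walks) are the cycles of the face-tracing
permutation. -/
def Face : Type _ := Quotient (Equiv.Perm.SameCycle.setoid R.facePerm)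

/-- The face whose boundary walk contains the dart `d`. -/
def faceOf (d : G.Dart) : R.Face := Quotient.mk (Equiv.Perm.SameCycle.setoid R.facePerm) d

end RotationSystem

/-- A planar embedding of a finite connected graph with at least one edge, up to topological
equivalence: a cyclic order of the edges around each vertex that satisfies Euler's formula
`n + f = m + 2` (that is, the surface obtained by gluing a disc to every face boundary walk is the
sphere), together with the choice of the outer face. -/
structure PlaneEmbedding (G : SimpleGraph V) extends RotationSystem G where
  connected : G.Connected
  euler : Nat.card V + Nat.card toRotationSystem.Face = Nat.card G.edgeSet + 2
  outer : toRotationSystem.Face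

namespace PlaneEmbedding

variable {G : SimpleGraph V} (P : PlaneEmbedding G)

/-- The edges incident to the outer face. -/
def outerEdges : Set (Sym2 V) :=
  {e | ∃ d : G.Dart, P.faceOf d = P.outer ∧ d.edge = e}

/-- The vertices incident to the outer face. -/
def outerVerts : Set V :=
  {v | ∃ d : G.Dart, P.faceOf d = P.outer ∧ d.fst = v}

/-- The graph obtained by removing the edges incident to the outer face. -/
def characteristicTree : SimpleGraph V := G.deleteEdges P.outerEdges

/-- A plane graph is a Halin graph if it is 3-connected and removing the edges incident to the outer
face leaves a tree whose internal (non-leaf) vertices have degree at least 3 in the tree and whose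
leaves are incident to the outer face. -/
structure IsHalin : Prop where
  three_connected : G.IsKConnected 3
  isTree : P.characteristicTree.IsTree
  three_le_degree : ∀ v, (P.characteristicTree.neighborSet v).ncard ≠ 1 →
    3 ≤ (P.characteristicTree.neighborSet v).ncard
  leaf_mem_outer : ∀ v, (P.characteristicTree.neighborSet v).ncard = 1 → v ∈ P.outerVerts

end PlaneEmbedding

/-- The placement `pos` of the vertices of `G` in the plane gives a planar straight-line drawing:
distinct vertices lie at distinct points, no edge passes through a vertex other than its
ends, and two distinct edges meet at most in a common end. -/
structure IsPlanarStraightLineDrawing (G : SimpleGraph V) (pos : V → ℝ × ℝ) : Prop where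
  injective : Function.Injective pos
  vertex_edge : ∀ u v w, G.Adj u v → pos w ∈ segment ℝ (pos u) (pos v) → w = u ∨ w = v
  edge_edge : ∀ u v w z, G.Adj u v → G.Adj w z → s(u, v) ≠ s(w, z) →
    segment ℝ (pos u) (pos v) ∩ segment ℝ (pos w) (pos z) ⊆
      pos '' (({u, v} : Set V) ∩ {w, z})

/-- The `i`-th line of a family of equispaced horizontal lines at mutual distance `δ`; lines are
numbered from top to bottom. -/
def levelLine (y₀ δ : ℝ) (i : ℤ) : Set (ℝ × ℝ) := {p | p.2 = y₀ - i * δ}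

/-- `pos` is a `k`-span weakly level planar drawing of `G` with respect to the levels
`levelLine y₀ δ i`. -/
structure IsKSWLPDrawing (G : SimpleGraph V) (k : ℕ) (y₀ δ : ℝ) (pos : V → ℝ × ℝ) : Prop where
  spacing_pos : 0 < δ
  planar : G.IsPlanarStraightLineDrawing pos
  on_level : ∀ v, ∃ i : ℤ, pos v ∈ levelLine y₀ δ i
  span_le : ∀ u v, G.Adj u v →
    {i : ℤ | (segment ℝ (pos u) (pos v) ∩ levelLine y₀ δ i).Nonempty}.encard ≤ k + 1

/-- `G` is `k`-SWLP: it has a `k`-span weakly level planar drawing. -/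
def IsKSWLP (G : SimpleGraph V) (k : ℕ) : Prop :=
  ∃ (y₀ δ : ℝ) (pos : V → ℝ × ℝ), G.IsKSWLPDrawing k y₀ δ pos

end SimpleGraph

/-! A drawing is reduced to integer data. Vertices get distinct abscissae `x` and integer levels
`lv`, and `LevelGood` lists the order conditions that exclude crossings when every edge joins equal
or consecutive levels.

Remove a vertex `t` of the outer face. It is a leaf of the characteristic tree, and the rest is a
plane tree rooted at the tree neighbour of `t`, together with a path through its leaves. List the
tree with each root directly after the branch of its first child, and let `x` be the position in
this list; only levels remain to be chosen. The first child may share the level of the root, on its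
left; the last child may share it, on its right; other children go one level up. The path edge
between consecutive branches leaves the last leaf of the part already drawn, on its right boundary
except perhaps for the root, and reaches the leftmost vertex of the next branch. So the data that
matter are the heights `α` and `β` of the first and last leaf above the root. `exists_drawings`
controls them by induction: a complete branching tree can be drawn with heights `(0, 1)` and with
`(1, 0)`, and variants with the root extreme on its level allow further gluing.

If the tree can be drawn with heights `(0, 0)`, then `t` goes one level below, at the far left, and
its three neighbours are all on level `0`. Mixing the drawings for `γ = 0` and `γ = 1` gives `(0,
0)` except for a few shapes with a small first branch. Those are treated by exchanging `t` with
another leaf at the same root, and the one remaining shape is `K₄` (`IsHalinAt.isKSWLP_of_snoc`).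

It remains to extract the plane tree from a rotation system. Euler's formula makes inner faces and
outer edges equinumerous, so each inner face has exactly one outer edge (`rim_unique`). Summing an
indicator function around a face shows that the rim enters and leaves each side of a tree edge
exactly once, through the two faces at that edge (`rim_leaves_iff`, `rim_enters_iff`). With
3-connectivity this puts only tree leaves on the outer face, and recursion around the vertices
builds the tree (`IsHalin.exists_isHalinAt`). -/

namespace SimpleGraph

/-! ### Order conditions on integer levels that force planarity -/

variable {V : Type*}

/-- The vertices in `S` are placed on integer levels `lv` with horizontal coordinates `x` such that
edges span at most one level and no two edges with ends in `S` cross. -/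
structure LevelGood (G : SimpleGraph V) (S : Set V) (x lv : V → ℤ) : Prop where
  span : ∀ u ∈ S, ∀ v ∈ S, G.Adj u v → lv v ≤ lv u + 1
  horiz : ∀ u ∈ S, ∀ v ∈ S, ∀ w ∈ S, G.Adj u v → lv u = lv v → lv w = lv u → x u < x w → x v ≤ x w
  cross : ∀ u ∈ S, ∀ v ∈ S, ∀ u' ∈ S, ∀ v' ∈ S, G.Adj u v → G.Adj u' v' → lv v = lv u + 1 →
    lv u' = lv u → lv v' = lv v → x u < x u' → x v ≤ x v'

/-- The point of the plane with integer coordinates `x v` and `lv v`. -/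
def gridPos (x lv : V → ℤ) (v : V) : ℝ × ℝ := ((x v : ℝ), (lv v : ℝ))

theorem mem_segment_gridPos {x lv : V → ℤ} {u v : V} {p : ℝ × ℝ}
    (hp : p ∈ segment ℝ (gridPos x lv u) (gridPos x lv v)) :
    ∃ t : ℝ, 0 ≤ t ∧ t ≤ 1 ∧ p.1 = (1 - t) * x u + t * x v ∧ p.2 = (1 - t) * lv u + t * lv v := by
  obtain ⟨s, t, hs, ht, hst, rfl⟩ := hp
  refine ⟨t, ht, by linarith, ?_, ?_⟩ <;>
    simp [gridPos, show s = 1 - t by linarith]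

/-- A point at integer height on an edge between consecutive levels is an end of the edge. -/
theorem eq_gridPos_of_slanted {x lv : V → ℤ} {u v : V} {p : ℝ × ℝ}
    (hp : p ∈ segment ℝ (gridPos x lv u) (gridPos x lv v)) (h : lv v = lv u + 1) (k : ℤ)
    (hk : p.2 = k) : p = gridPos x lv u ∨ p = gridPos x lv v := by
  obtain ⟨t, h0, h1, hx, hy⟩ := mem_segment_gridPos hp
  have hv : (lv v : ℝ) = lv u + 1 := by exact_mod_cast h
  have htk : t = ((k - lv u : ℤ) : ℝ) := by push_cast; rw [hv] at hy; linarith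
  have a0 : 0 ≤ k - lv u := by rw [htk] at h0; exact_mod_cast h0
  have a1 : k - lv u ≤ 1 := by rw [htk] at h1; exact_mod_cast h1
  have : k - lv u = 0 ∨ k - lv u = 1 := by omega
  rcases this with e | e
  · left
    rw [e] at htk
    ext <;> simp [gridPos, hx, hy, htk]
  · right
    rw [e] at htk
    ext <;> simp [gridPos, hx, hy, htk]

section Drawing

variable {G : SimpleGraph V} {x lv : V → ℤ}

theorem LevelGood.vertex_edge (h : G.LevelGood Set.univ x lv) (hx : Function.Injective x)
    {u v w : V} (huv : G.Adj u v)
    (hw : gridPos x lv w ∈ segment ℝ (gridPos x lv u) (gridPos x lv v)) : w = u ∨ w = v := by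
  have hinj : Function.Injective (gridPos x lv) := by
    intro a b hab
    have : (x a : ℝ) = x b := congrArg Prod.fst hab
    exact hx (by exact_mod_cast this)
  have s1 := h.span u trivial v trivial huv
  have s2 := h.span v trivial u trivial huv.symm
  rcases (by omega : lv v = lv u + 1 ∨ lv u = lv v + 1 ∨ lv u = lv v) with e | e | e
  · rcases eq_gridPos_of_slanted hw e (lv w) rfl with e | e
    · exact Or.inl (hinj e)
    · exact Or.inr (hinj e)
  · rw [segment_symm] at hw
    rcases eq_gridPos_of_slanted hw e (lv w) rfl with e | e
    · exact Or.inr (hinj e)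
    · exact Or.inl (hinj e)
  · obtain ⟨t, h0, h1, h2, h3⟩ := mem_segment_gridPos hw
    simp only [gridPos] at h2 h3
    have hlw : lv w = lv u := by
      have : (lv w : ℝ) = lv u := by rw [h3, e]; ring
      exact_mod_cast this
    by_contra! hne
    have n1 : x w ≠ x u := fun q => hne.1 (hx q)
    have n2 : x w ≠ x v := fun q => hne.2 (hx q)
    have k1 := h.horiz u trivial v trivial w trivial huv e hlw
    have k2 := h.horiz v trivial u trivial w trivial huv.symm e.symm (by omega)
    rcases (by omega : (x u < x w ∧ x v < x w) ∨ (x w < x u ∧ x w < x v)) with ⟨a, b⟩ | ⟨a, b⟩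
    · have a' : (x u : ℝ) < x w := by exact_mod_cast a
      have b' : (x v : ℝ) < x w := by exact_mod_cast b
      rcases h1.eq_or_lt with rfl | h1
      · linarith
      · nlinarith
    · have a' : (x w : ℝ) < x u := by exact_mod_cast a
      have b' : (x w : ℝ) < x v := by exact_mod_cast b
      rcases h1.eq_or_lt with rfl | h1
      · linarith
      · nlinarith

/-- Two distinct upward edges can only meet in the position of a vertex. -/
theorem LevelGood.exists_gridPos_of_le (h : G.LevelGood Set.univ x lv) (hx : Function.Injective x)
    {u v w z : V} (huv : G.Adj u v) (hwz : G.Adj w z) (hne : s(u, v) ≠ s(w, z))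
    (h1 : lv u ≤ lv v) (h2 : lv w ≤ lv z) (h1x : lv u = lv v → x u < x v)
    (h2x : lv w = lv z → x w < x z) {p : ℝ × ℝ}
    (hp : p ∈ segment ℝ (gridPos x lv u) (gridPos x lv v))
    (hq : p ∈ segment ℝ (gridPos x lv w) (gridPos x lv z)) : ∃ c, p = gridPos x lv c := by
  have s1 := h.span u trivial v trivial huv
  have s2 := h.span w trivial z trivial hwz
  obtain ⟨t, t0, t1, px, py⟩ := mem_segment_gridPos hp
  obtain ⟨r, r0, r1, qx, qy⟩ := mem_segment_gridPos hq
  rcases (by omega : lv v = lv u + 1 ∨ lv u = lv v) with e | e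
  · by_cases hk : ∃ k : ℤ, p.2 = k
    · obtain ⟨k, hk⟩ := hk
      rcases eq_gridPos_of_slanted hp e k hk with e | e
      exacts [⟨_, e⟩, ⟨_, e⟩]
    -- At a non-integer height both edges are slanted and lie between the same two levels, so they
    -- meet at the same parameter. There `cross` fixes the order of the two points.
    · have e2 : lv z = lv w + 1 := by
        by_contra hh
        have : lv z = lv w := by omega
        exact hk ⟨lv w, by rw [qy, this]; ring⟩
      have ev : (lv v : ℝ) = lv u + 1 := by exact_mod_cast e
      have ez : (lv z : ℝ) = lv w + 1 := by exact_mod_cast e2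
      have py' : p.2 = lv u + t := by rw [py, ev]; ring
      have qy' : p.2 = lv w + r := by rw [qy, ez]; ring
      have tn0 : t ≠ 0 := fun q => hk ⟨lv u, by rw [py', q]; ring⟩
      have tn1 : t ≠ 1 := fun q => hk ⟨lv v, by rw [py', q, ev]⟩
      have tp : 0 < t := lt_of_le_of_ne t0 tn0.symm
      have tl : t < 1 := lt_of_le_of_ne t1 tn1
      have d1 : (lv u : ℝ) < lv w + 1 := by linarith
      have d2 : (lv w : ℝ) < lv u + 1 := by
        rcases r0.eq_or_lt with rfl | _ <;> linarith
      have el : lv w = lv u := by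
        have d1' : lv u < lv w + 1 := by exact_mod_cast d1
        have d2' : lv w < lv u + 1 := by exact_mod_cast d2
        omega
      have rt : r = t := by rw [el] at qy'; linarith
      subst rt
      have k1 := h.cross u trivial v trivial w trivial z trivial huv hwz e el (by omega)
      have k2 := h.cross w trivial z trivial u trivial v trivial hwz huv e2 el.symm (by omega)
      rcases lt_trichotomy (x u) (x w) with c | c | c
      · have c1 : (x u : ℝ) < x w := by exact_mod_cast c
        have c2 : (x v : ℝ) ≤ x z := by exact_mod_cast k1 c
        nlinarith
      · have c' : (x u : ℝ) = x w := by exact_mod_cast c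
        have : (x v : ℝ) = x z := by
          have : r * (x v : ℝ) = r * x z := by rw [c'] at px; linarith
          exact mul_left_cancel₀ tn0 this
        have hvz : v = z := hx (by exact_mod_cast this)
        exact absurd (by rw [hx c, hvz]) hne
      · have c1 : (x w : ℝ) < x u := by exact_mod_cast c
        have c2 : (x z : ℝ) ≤ x v := by exact_mod_cast k2 c
        nlinarith
  · have pk : p.2 = lv u := by rw [py, e]; ring
    rcases (by omega : lv z = lv w + 1 ∨ lv w = lv z) with e2 | e2
    · rcases eq_gridPos_of_slanted hq e2 (lv u) pk with e | e
      exacts [⟨_, e⟩, ⟨_, e⟩]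
    · have qk : p.2 = lv w := by rw [qy, e2]; ring
      have el : lv w = lv u := by
        have : (lv w : ℝ) = lv u := by rw [← qk, pk]
        exact_mod_cast this
      have u1 : (x u : ℝ) < x v := by exact_mod_cast h1x e
      have w1 : (x w : ℝ) < x z := by exact_mod_cast h2x e2
      have p1 : (x u : ℝ) ≤ p.1 := by rw [px]; nlinarith
      have p2 : p.1 ≤ x v := by rw [px]; nlinarith
      have q1 : (x w : ℝ) ≤ p.1 := by rw [qx]; nlinarith
      have q2 : p.1 ≤ x z := by rw [qx]; nlinarith
      rcases lt_trichotomy (x u) (x w) with c | c | c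
      · have c1 : (x v : ℝ) ≤ x w := by
          exact_mod_cast h.horiz u trivial v trivial w trivial huv e el c
        exact ⟨w, Prod.ext (le_antisymm (by simp [gridPos]; linarith) q1) qk⟩
      · have huw : u = w := hx c
        subst huw
        have k1 := h.horiz u trivial v trivial z trivial huv e (by omega)
        have k2 := h.horiz u trivial z trivial v trivial hwz e2 (by omega)
        have hvz : v = z := hx (le_antisymm (k1 (h2x e2)) (k2 (h1x e)))
        exact absurd (by rw [hvz]) hne
      · have c1 : (x z : ℝ) ≤ x u := by
          exact_mod_cast h.horiz w trivial z trivial u trivial hwz e2 el.symm c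
        exact ⟨u, Prod.ext (le_antisymm (by simp [gridPos]; linarith) p1) pk⟩

theorem LevelGood.exists_gridPos (h : G.LevelGood Set.univ x lv) (hx : Function.Injective x)
    {u v w z : V} (huv : G.Adj u v) (hwz : G.Adj w z) (hne : s(u, v) ≠ s(w, z)) {p : ℝ × ℝ}
    (hp : p ∈ segment ℝ (gridPos x lv u) (gridPos x lv v))
    (hq : p ∈ segment ℝ (gridPos x lv w) (gridPos x lv z)) : ∃ c, p = gridPos x lv c := by
  have key : ∀ {u v : V}, G.Adj u v → p ∈ segment ℝ (gridPos x lv u) (gridPos x lv v) →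
      ∃ u' v', G.Adj u' v' ∧ p ∈ segment ℝ (gridPos x lv u') (gridPos x lv v') ∧
        s(u', v') = s(u, v) ∧ lv u' ≤ lv v' ∧ (lv u' = lv v' → x u' < x v') := by
    intro u v huv hp
    have hne : x u ≠ x v := fun q => huv.ne (hx q)
    by_cases hc : lv u < lv v ∨ (lv u = lv v ∧ x u < x v)
    · exact ⟨u, v, huv, hp, rfl, by omega, by omega⟩
    · exact ⟨v, u, huv.symm, by rwa [segment_symm], Sym2.eq_swap, by omega, by omega⟩
  obtain ⟨u', v', a1, a2, a3, a4, a5⟩ := key huv hp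
  obtain ⟨w', z', b1, b2, b3, b4, b5⟩ := key hwz hq
  exact h.exists_gridPos_of_le hx a1 b1 (by rwa [a3, b3]) a4 b4 a5 b5 a2 b2

theorem LevelGood.isKSWLP (h : G.LevelGood Set.univ x lv) (hx : Function.Injective x) :
    G.IsKSWLP 1 := by
  refine ⟨0, 1, gridPos x lv, one_pos, ⟨?_, ?_, ?_⟩, ?_, ?_⟩
  · intro a b hab
    have : (x a : ℝ) = x b := congrArg Prod.fst hab
    exact hx (by exact_mod_cast this)
  · intro u v w huv hw
    exact h.vertex_edge hx huv hw
  · rintro u v w z huv hwz hne p ⟨hp, hq⟩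
    obtain ⟨c, rfl⟩ := h.exists_gridPos hx huv hwz hne hp hq
    exact ⟨c, ⟨h.vertex_edge hx huv hp, h.vertex_edge hx hwz hq⟩, rfl⟩
  · intro v
    -- The index changes sign because `levelLine` numbers levels downwards, while `lv` grows
    -- upwards.
    exact ⟨-lv v, by simp [levelLine, gridPos]⟩
  · intro u v huv
    have s1 := h.span u trivial v trivial huv
    have s2 := h.span v trivial u trivial huv.symm
    have hsub : {i : ℤ | (segment ℝ (gridPos x lv u) (gridPos x lv v) ∩
        levelLine 0 1 i).Nonempty} ⊆ {-lv u, -lv v} := by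
      rintro i ⟨p, hp, hi⟩
      have hi' : p.2 = ((-i : ℤ) : ℝ) := by simpa [levelLine] using hi
      have conv {q : V} (e : p = gridPos x lv q) : i = -lv q := by
        have : ((-i : ℤ) : ℝ) = lv q := by rw [← hi', e]; rfl
        have : -i = lv q := by exact_mod_cast this
        omega
      rcases (by omega : lv v = lv u + 1 ∨ lv u = lv v + 1 ∨ lv u = lv v) with e | e | e
      · exact (eq_gridPos_of_slanted hp e _ hi').imp conv conv
      · rw [segment_symm] at hp
        exact ((eq_gridPos_of_slanted hp e _ hi').imp conv conv).symm
      · obtain ⟨t, -, -, -, hy⟩ := mem_segment_gridPos hp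
        left
        have : ((-i : ℤ) : ℝ) = lv u := by rw [← hi', hy, e]; ring
        have : -i = lv u := by exact_mod_cast this
        omega
    refine (Set.encard_le_encard hsub).trans ((Set.encard_insert_le _ _).trans ?_)
    rw [Set.encard_singleton]
    norm_num

end Drawing

theorem LevelGood.congr {G : SimpleGraph V} {S : Set V} {x lv lv' : V → ℤ}
    (h : G.LevelGood S x lv) (he : ∀ w ∈ S, lv' w = lv w) : G.LevelGood S x lv' := by
  refine ⟨?_, ?_, ?_⟩
  · intro u hu v hv
    rw [he u hu, he v hv]
    exact h.span u hu v hv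
  · intro u hu v hv w hw
    rw [he u hu, he v hv, he w hw]
    exact h.horiz u hu v hv w hw
  · intro u hu v hv u' hu' v' hv'
    rw [he u hu, he v hv, he u' hu', he v' hv']
    exact h.cross u hu v hv u' hu' v' hv'

/-- Two drawings placed side by side form a drawing if the edges between them do not cross each
other or an edge of one of the two parts. -/
theorem LevelGood.union {G : SimpleGraph V} {S S' : Set V} {x lv : V → ℤ}
    (h : G.LevelGood S x lv) (h' : G.LevelGood S' x lv) (hlt : ∀ a ∈ S, ∀ b ∈ S', x a < x b)
    (hc : ∀ a ∈ S, ∀ b ∈ S', G.Adj a b →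
      (lv a = lv b ∧ (∀ w ∈ S, lv w = lv a → x w ≤ x a) ∧ (∀ w ∈ S', lv w = lv a → x b ≤ x w)) ∨
      (lv b = lv a + 1 ∧
        (∀ u ∈ S, ∀ v ∈ S, G.Adj u v → lv u = lv a → lv v = lv b → x u ≤ x a) ∧
        (∀ u ∈ S', ∀ v ∈ S', G.Adj u v → lv u = lv a → lv v = lv b → x b ≤ x v)) ∨
      (lv a = lv b + 1 ∧
        (∀ u ∈ S, ∀ v ∈ S, G.Adj u v → lv u = lv b → lv v = lv a → x v ≤ x a) ∧
        (∀ u ∈ S', ∀ v ∈ S', G.Adj u v → lv u = lv b → lv v = lv a → x b ≤ x u)))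
    (hcc : ∀ a ∈ S, ∀ b ∈ S', ∀ a' ∈ S, ∀ b' ∈ S', G.Adj a b → G.Adj a' b' →
      (lv b = lv a + 1 → lv a' = lv a → lv b' = lv b → x a < x a' → x b ≤ x b') ∧
      (lv a = lv b + 1 → lv a' = lv a → lv b' = lv b → x b < x b' → x a ≤ x a') ∧
      ¬ (lv b = lv a + 1 ∧ lv a' = lv b ∧ lv b' = lv a)) :
    G.LevelGood (S ∪ S') x lv := by
  refine ⟨?_, ?_, ?_⟩
  · rintro u (hu | hu) v (hv | hv) huv
    · exact h.span u hu v hv huv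
    · rcases hc u hu v hv huv with k | k | k <;> omega
    · rcases hc v hv u hu huv.symm with k | k | k <;> omega
    · exact h'.span u hu v hv huv
  · rintro u (hu | hu) v (hv | hv) w (hw | hw) huv e ew lt
    · exact h.horiz u hu v hv w hw huv e ew lt
    · exact (hlt v hv w hw).le
    · rcases hc u hu v hv huv with k | k | k
      · have := k.2.1 w hw ew; omega
      · omega
      · omega
    · rcases hc u hu v hv huv with k | k | k
      · exact k.2.2 w hw ew
      · omega
      · omega
    · have := hlt w hw u hu; omega
    · have := hlt v hv w hw; omega
    · have := hlt w hw u hu; omega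
    · exact h'.horiz u hu v hv w hw huv e ew lt
  · rintro u (hu | hu) v (hv | hv) u' (hu' | hu') v' (hv' | hv') huv huv' e e1 e2 lt
    · exact h.cross u hu v hv u' hu' v' hv' huv huv' e e1 e2 lt
    · exact (hlt v hv v' hv').le
    · rcases hc v' hv' u' hu' huv'.symm with k | k | k
      · omega
      · omega
      · exact k.2.1 u hu v hv huv (by omega) (by omega)
    · exact (hlt v hv v' hv').le
    · rcases hc u hu v hv huv with k | k | k
      · omega
      · have := k.2.1 u' hu' v' hv' huv' (by omega) (by omega); omega
      · omega
    · exact (hcc u hu v hv u' hu' v' hv' huv huv').1 e e1 e2 lt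
    · exact absurd ⟨e, by omega, by omega⟩ (hcc u hu v hv v' hv' u' hu' huv huv'.symm).2.2
    · rcases hc u hu v hv huv with k | k | k
      · omega
      · exact k.2.2 u' hu' v' hv' huv' (by omega) (by omega)
      · omega
    · have := hlt u' hu' u hu; omega
    · have := hlt u' hu' u hu; omega
    · exact (hcc v hv u hu v' hv' u' hu' huv.symm huv'.symm).2.1 (by omega) (by omega) (by omega) lt
    · exact (hlt v hv v' hv').le
    · have := hlt u' hu' u hu; omega
    · have := hlt u' hu' u hu; omega
    · rcases hc v' hv' u' hu' huv'.symm with k | k | k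
      · omega
      · omega
      · have := k.2.2 u hu v hv huv (by omega) (by omega); omega
    · exact h'.cross u hu v hv u' hu' v' hv' huv huv' e e1 e2 lt

end SimpleGraph

/-! ### Plane trees and their horizontal order -/

/-- Rooted plane trees, built by adding children from left to right: `single v c` has the root `v`
with the only child `c`, and `snoc A X` is obtained from `A` by adding `X` as the last child of the
root. -/
inductive PlaneTree (V : Type*)
  | leaf (v : V) : PlaneTree V
  | single (v : V) (c : PlaneTree V) : PlaneTree V
  | snoc (A X : PlaneTree V) : PlaneTree V

namespace PlaneTree

variable {V : Type*}

/-- The vertices of a plane tree; the root comes immediately after the first child. -/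
def verts : PlaneTree V → List V
  | leaf v => [v]
  | single v c => c.verts ++ [v]
  | snoc A X => A.verts ++ X.verts

/-- The root of a plane tree. -/
def root : PlaneTree V → V
  | leaf v => v
  | single v _ => v
  | snoc A _ => A.root

/-- The first leaf of a plane tree. -/
def firstLeaf : PlaneTree V → V
  | leaf v => v
  | single _ c => c.firstLeaf
  | snoc A _ => A.firstLeaf

/-- The last leaf of a plane tree. -/
def lastLeaf : PlaneTree V → V
  | leaf v => v
  | single _ c => c.lastLeaf
  | snoc _ X => X.lastLeaf

/-- The root is not the only vertex. -/
def Branching : PlaneTree V → Prop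
  | leaf _ => False
  | single _ _ => True
  | snoc _ _ => True

/-- The root does not have exactly one child. -/
def Complete : PlaneTree V → Prop
  | leaf _ => True
  | single _ _ => False
  | snoc _ _ => True

/-- The edges of `G` between vertices of the plane tree join a vertex to its parent or are the edges
between consecutive leaves, and no vertex has exactly one child, except perhaps the root. -/
def Fits (G : SimpleGraph V) : PlaneTree V → Prop
  | leaf _ => True
  | single v c => c.Fits G ∧ c.Complete ∧ ∀ y ∈ c.verts, G.Adj y v → y = c.root
  | snoc A X => A.Fits G ∧ A.Branching ∧ X.Fits G ∧ X.Complete ∧ ∀ a ∈ A.verts, ∀ y ∈ X.verts,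
      G.Adj a y → (a = A.root ∧ y = X.root) ∨ (a = A.lastLeaf ∧ y = X.firstLeaf)

theorem root_mem : ∀ A : PlaneTree V, A.root ∈ A.verts
  | leaf v => by simp [root, verts]
  | single v c => by simp [root, verts]
  | snoc A X => by simp [root, verts, root_mem A]

theorem firstLeaf_mem : ∀ A : PlaneTree V, A.firstLeaf ∈ A.verts
  | leaf v => by simp [firstLeaf, verts]
  | single v c => by simp [firstLeaf, verts, firstLeaf_mem c]
  | snoc A X => by simp [firstLeaf, verts, firstLeaf_mem A]

theorem lastLeaf_mem : ∀ A : PlaneTree V, A.lastLeaf ∈ A.verts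
  | leaf v => by simp [lastLeaf, verts]
  | single v c => by simp [lastLeaf, verts, lastLeaf_mem c]
  | snoc A X => by simp [lastLeaf, verts, lastLeaf_mem X]

/-- The vertices of the plane tree are listed by increasing horizontal coordinate. -/
def Ordered (x : V → ℤ) (A : PlaneTree V) : Prop := A.verts.Pairwise (fun a b => x a < x b)

section Ordered

variable {x : V → ℤ} {v : V} {c A X : PlaneTree V}

theorem ordered_single : (single v c).Ordered x ↔ c.Ordered x ∧ ∀ a ∈ c.verts, x a < x v := by
  simp [Ordered, verts, List.pairwise_append]

theorem ordered_snoc : (snoc A X).Ordered x ↔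
    A.Ordered x ∧ X.Ordered x ∧ ∀ a ∈ A.verts, ∀ b ∈ X.verts, x a < x b := by
  simp [Ordered, verts, List.pairwise_append]

theorem Ordered.firstLeaf_le (h : A.Ordered x) : ∀ w ∈ A.verts, x A.firstLeaf ≤ x w := by
  induction A with
  | leaf v => simp [verts, firstLeaf]
  | single v c ih =>
    rw [ordered_single] at h
    intro w hw
    rcases List.mem_append.1 hw with hw | hw
    · exact ih h.1 w hw
    · rw [List.mem_singleton.1 hw]
      exact (h.2 _ c.firstLeaf_mem).le
  | snoc A X ihA ihX =>
    rw [ordered_snoc] at h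
    intro w hw
    rcases List.mem_append.1 hw with hw | hw
    · exact ihA h.1 w hw
    · exact (h.2.2 _ A.firstLeaf_mem _ hw).le

/-- Only a root standing after its sole child can be to the right of the last leaf. Hence a path
edge to the next branch has to be checked against nothing in `A` but this root. -/
theorem Ordered.le_lastLeaf {G : SimpleGraph V} (h : A.Ordered x) (hf : A.Fits G) :
    ∀ w ∈ A.verts, (A.Complete ∨ w ≠ A.root) → x w ≤ x A.lastLeaf := by
  induction A with
  | leaf v => simp [verts, lastLeaf]
  | single v c ih =>
    rw [ordered_single] at h
    intro w hw hr
    rcases List.mem_append.1 hw with hw | hw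
    · exact ih h.1 hf.1 w hw (Or.inl hf.2.1)
    · rcases hr with hr | hr
      · exact hr.elim
      · exact absurd (List.mem_singleton.1 hw) hr
  | snoc A X ihA ihX =>
    rw [ordered_snoc] at h
    intro w hw hr
    rcases List.mem_append.1 hw with hw | hw
    · exact (h.2.2 _ hw _ X.lastLeaf_mem).le
    · exact ihX h.2.1 hf.2.2.1 w hw (Or.inl hf.2.2.2.1)

end Ordered

/-! ### Gluing drawings of branches -/

/-- A drawing of a plane tree with root on level `j`, first leaf on level `j + α`, last leaf on
level `j + β`, and no vertex below level `j`. -/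
structure Drawn (G : SimpleGraph V) (x : V → ℤ) (A : PlaneTree V) (lv : V → ℤ) (j α β : ℤ) :
    Prop where
  good : G.LevelGood {w | w ∈ A.verts} x lv
  ge : ∀ w ∈ A.verts, j ≤ lv w
  root : lv A.root = j
  firstLeaf : lv A.firstLeaf = j + α
  lastLeaf : lv A.lastLeaf = j + β

/-- The root is the rightmost vertex on level `j`. -/
def RootLast (x : V → ℤ) (A : PlaneTree V) (lv : V → ℤ) (j : ℤ) : Prop :=
  ∀ w ∈ A.verts, lv w = j → x w ≤ x A.root

/-- The root is the leftmost vertex on level `j`. -/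
def RootFirst (x : V → ℤ) (A : PlaneTree V) (lv : V → ℤ) (j : ℤ) : Prop :=
  ∀ w ∈ A.verts, lv w = j → x A.root ≤ x w

section Draw

variable {G : SimpleGraph V} {x lv lv' : V → ℤ} {v : V} {c A X : PlaneTree V} {j α β α' β' : ℤ}

theorem Drawn.congr (h : A.Drawn G x lv j α β) (he : ∀ w ∈ A.verts, lv' w = lv w) :
    A.Drawn G x lv' j α β := by
  refine ⟨h.good.congr he, ?_, ?_, ?_, ?_⟩
  · intro w hw
    rw [he w hw]
    exact h.ge w hw
  · rw [he _ A.root_mem, h.root]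
  · rw [he _ A.firstLeaf_mem, h.firstLeaf]
  · rw [he _ A.lastLeaf_mem, h.lastLeaf]

theorem RootLast.congr (h : A.RootLast x lv j) (he : ∀ w ∈ A.verts, lv' w = lv w) :
    A.RootLast x lv' j := fun w hw hl => h w hw (by rw [← he w hw, hl])

theorem RootFirst.congr (h : A.RootFirst x lv j) (he : ∀ w ∈ A.verts, lv' w = lv w) :
    A.RootFirst x lv' j := fun w hw hl => h w hw (by rw [← he w hw, hl])

theorem Drawn.first_nonneg (h : A.Drawn G x lv j α β) : 0 ≤ α := by
  have := h.ge _ A.firstLeaf_mem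
  have := h.firstLeaf
  omega

theorem Drawn.last_nonneg (h : A.Drawn G x lv j α β) : 0 ≤ β := by
  have := h.ge _ A.lastLeaf_mem
  have := h.lastLeaf
  omega

theorem drawn_leaf (h : lv v = j) : (leaf v).Drawn G x lv j 0 0 := by
  refine ⟨⟨?_, ?_, ?_⟩, ?_, ?_, ?_, ?_⟩ <;> simp [verts, root, firstLeaf, lastLeaf, h]

theorem levelGood_singleton (v : V) : G.LevelGood {w | w ∈ [v]} x lv := by
  refine ⟨?_, ?_, ?_⟩ <;> simp

theorem verts_single (v : V) (c : PlaneTree V) :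
    {w | w ∈ (single v c).verts} = {w | w ∈ c.verts} ∪ {w | w ∈ [v]} := by
  ext w; simp [verts, or_comm]

theorem verts_snoc (A X : PlaneTree V) :
    {w | w ∈ (snoc A X).verts} = {w | w ∈ A.verts} ∪ {w | w ∈ X.verts} := by
  ext w; simp [verts]

theorem mem_single {w : V} : w ∈ (single v c).verts ↔ w ∈ c.verts ∨ w = v := by
  simp only [verts, List.mem_append, List.mem_singleton]

theorem mem_snoc {w : V} : w ∈ (snoc A X).verts ↔ w ∈ A.verts ∨ w ∈ X.verts := by simp [verts]

/-- Draw a root to the right of its first child on the same level. -/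
theorem Drawn.single_flat (h : c.Drawn G x lv j α β) (hl : c.RootLast x lv j)
    (hf : (single v c).Fits G) (ho : (single v c).Ordered x) (hv : lv v = j) :
    (single v c).Drawn G x lv j α β ∧ (single v c).RootLast x lv j := by
  rw [ordered_single] at ho
  obtain ⟨hf1, hf2, hf3⟩ := hf
  refine ⟨⟨?_, ?_, hv, h.firstLeaf, h.lastLeaf⟩, ?_⟩
  · rw [verts_single]
    refine h.good.union (levelGood_singleton v) (by simpa using ho.2) ?_ ?_
    · simp only [List.mem_singleton, Set.mem_ofPred_eq]
      rintro a ha b rfl hab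
      obtain rfl := hf3 a ha hab
      left
      refine ⟨by rw [h.root, hv], ?_, by simp⟩
      intro w hw e
      exact hl w hw (by rw [e, h.root])
    · simp only [List.mem_singleton, Set.mem_ofPred_eq]
      rintro a ha b rfl a' ha' b rfl hab hab'
      obtain rfl := hf3 a ha hab
      obtain rfl := hf3 a' ha' hab'
      omega
  · intro w hw
    rcases mem_single.1 hw with hw | rfl
    exacts [h.ge w hw, hv.ge]
  · intro w hw _
    rcases mem_single.1 hw with hw | rfl
    exacts [(ho.2 w hw).le, le_rfl]

/-- Draw a root one level below its first child. -/
theorem Drawn.single_up (h : c.Drawn G x lv (j + 1) α β)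
    (hf : (single v c).Fits G) (ho : (single v c).Ordered x) (hv : lv v = j) :
    (single v c).Drawn G x lv j (1 + α) (1 + β) ∧ (single v c).RootLast x lv j ∧
      (single v c).RootFirst x lv j := by
  rw [ordered_single] at ho
  obtain ⟨hf1, hf2, hf3⟩ := hf
  refine ⟨⟨?_, ?_, hv, ?_, ?_⟩, ?_, ?_⟩
  · rw [verts_single]
    refine h.good.union (levelGood_singleton v) (by simpa using ho.2) ?_ ?_
    · simp only [List.mem_singleton, Set.mem_ofPred_eq]
      rintro a ha b rfl hab
      obtain rfl := hf3 a ha hab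
      right; right
      refine ⟨by rw [h.root, hv], ?_, by simp⟩
      intro u hu v' hv' _ e
      have := h.ge u hu
      omega
    · simp only [List.mem_singleton, Set.mem_ofPred_eq]
      rintro a ha b rfl a' ha' b rfl hab hab'
      obtain rfl := hf3 a ha hab
      obtain rfl := hf3 a' ha' hab'
      omega
  · intro w hw
    rcases mem_single.1 hw with hw | rfl
    · have := h.ge w hw; omega
    · omega
  · have := h.firstLeaf; simp only [PlaneTree.firstLeaf]; omega
  · have := h.lastLeaf; simp only [PlaneTree.lastLeaf]; omega
  · intro w hw _
    rcases mem_single.1 hw with hw | rfl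
    exacts [(ho.2 w hw).le, le_rfl]
  · intro w hw e
    rcases mem_single.1 hw with hw | rfl
    · have := h.ge w hw; omega
    · exact le_rfl

/-- Draw a further child one level above the root. -/
theorem Drawn.snoc_up (h : A.Drawn G x lv j α β) (hl : A.RootLast x lv j)
    (hflat : β = 0 → ∀ w ∈ A.verts, lv w = j) (h' : X.Drawn G x lv (j + 1) α' β')
    (hf : (snoc A X).Fits G) (ho : (snoc A X).Ordered x) (h1 : β ≤ α' + 2) (h2 : α' ≤ β) :
    (snoc A X).Drawn G x lv j α (1 + β') ∧ (snoc A X).RootLast x lv j ∧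
      (A.RootFirst x lv j → (snoc A X).RootFirst x lv j) := by
  rw [ordered_snoc] at ho
  obtain ⟨hf1, hf2, hf3, hf4, hf5⟩ := hf
  obtain ⟨o1, o2, o3⟩ := ho
  have hr := h.root
  have hr' := h'.root
  have hll := h.lastLeaf
  have hfl := h'.firstLeaf
  have hβ := h.last_nonneg
  have hα := h'.first_nonneg
  have rl : x A.lastLeaf ≤ x A.root ∨ 1 ≤ β := by
    rcases hβ.eq_or_lt with e | e
    · left; exact hl _ A.lastLeaf_mem (by omega)
    · right; omega
  refine ⟨⟨?_, ?_, hr, h.firstLeaf, ?_⟩, ?_, ?_⟩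
  · rw [verts_snoc]
    refine h.good.union h'.good o3 ?_ ?_
    · simp only [Set.mem_ofPred_eq]
      rintro a ha b hb hab
      rcases hf5 a ha b hb hab with ⟨rfl, rfl⟩ | ⟨rfl, rfl⟩
      · right; left
        refine ⟨by omega, ?_, ?_⟩
        · intro u hu _ _ _ e _
          exact hl u hu (by omega)
        · intro u hu v hv _ e _
          have := h'.ge u hu
          omega
      · rcases (by omega : lv A.lastLeaf = lv X.firstLeaf ∨ lv X.firstLeaf = lv A.lastLeaf + 1 ∨
          lv A.lastLeaf = lv X.firstLeaf + 1) with e | e | e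
        · left
          refine ⟨e, ?_, fun w hw _ => o2.firstLeaf_le w hw⟩
          intro w hw ew
          refine o1.le_lastLeaf hf1 w hw (Or.inr ?_)
          rintro rfl
          omega
        · right; left
          refine ⟨e, ?_, fun _ _ w hw _ _ _ => o2.firstLeaf_le w hw⟩
          intro u hu v hv _ eu ev
          refine o1.le_lastLeaf hf1 u hu (Or.inr ?_)
          -- A root on the level of the last leaf forces `β = 0`; then `hflat` puts all of `A` on
          -- level `j`, so no edge inside `A` rises from the root.
          rintro rfl
          have := hflat (by omega) v hv
          omega
        · right; right
          refine ⟨e, ?_, fun w hw _ _ _ _ _ => o2.firstLeaf_le w hw⟩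
          intro u hu v hv _ eu ev
          refine o1.le_lastLeaf hf1 v hv (Or.inr ?_)
          rintro rfl
          omega
    · simp only [Set.mem_ofPred_eq]
      rintro a ha b hb a' ha' b' hb' hab hab'
      have := o2.firstLeaf_le _ X.root_mem
      rcases hf5 a ha b hb hab with ⟨rfl, rfl⟩ | ⟨rfl, rfl⟩ <;>
      rcases hf5 a' ha' b' hb' hab' with ⟨rfl, rfl⟩ | ⟨rfl, rfl⟩ <;>
      · refine ⟨?_, ?_, ?_⟩ <;> intros <;> omega
  · intro w hw
    rcases mem_snoc.1 hw with hw | hw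
    · exact h.ge w hw
    · have := h'.ge w hw; omega
  · have := h'.lastLeaf; simp only [PlaneTree.lastLeaf]; omega
  · intro w hw e
    rcases mem_snoc.1 hw with hw | hw
    · exact hl w hw e
    · have := h'.ge w hw; omega
  · intro hfst w hw e
    rcases mem_snoc.1 hw with hw | hw
    · exact hfst w hw e
    · have := h'.ge w hw; omega

/-- Draw the last child on the level of the root. -/
theorem Drawn.snoc_flat (h : A.Drawn G x lv j α β) (hl : A.RootLast x lv j)
    (hflat : β = 0 → ∀ w ∈ A.verts, lv w = j) (h' : X.Drawn G x lv j α' β')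
    (hl' : X.RootFirst x lv j)
    (hf : (snoc A X).Fits G) (ho : (snoc A X).Ordered x) (h1 : β ≤ α' + 1) (h2 : α' ≤ β + 1)
    (h0 : 1 ≤ β ∨ 1 ≤ α') :
    (snoc A X).Drawn G x lv j α β' ∧ (A.RootFirst x lv j → (snoc A X).RootFirst x lv j) := by
  rw [ordered_snoc] at ho
  obtain ⟨hf1, hf2, hf3, hf4, hf5⟩ := hf
  obtain ⟨o1, o2, o3⟩ := ho
  have hr := h.root
  have hr' := h'.root
  have hll := h.lastLeaf
  have hfl := h'.firstLeaf
  have hβ := h.last_nonneg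
  have hα := h'.first_nonneg
  refine ⟨⟨?_, ?_, hr, h.firstLeaf, h'.lastLeaf⟩, ?_⟩
  · rw [verts_snoc]
    refine h.good.union h'.good o3 ?_ ?_
    · simp only [Set.mem_ofPred_eq]
      rintro a ha b hb hab
      rcases hf5 a ha b hb hab with ⟨rfl, rfl⟩ | ⟨rfl, rfl⟩
      · left
        exact ⟨by omega, fun w hw e => hl w hw (by omega), fun w hw e => hl' w hw (by omega)⟩
      · rcases (by omega : lv A.lastLeaf = lv X.firstLeaf ∨ lv X.firstLeaf = lv A.lastLeaf + 1 ∨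
          lv A.lastLeaf = lv X.firstLeaf + 1) with e | e | e
        · left
          refine ⟨e, ?_, fun w hw _ => o2.firstLeaf_le w hw⟩
          intro w hw ew
          refine o1.le_lastLeaf hf1 w hw (Or.inr ?_)
          -- This is where `h0` is needed: if both leaves were on level `j`, the edge between them
          -- would run through the root.
          rintro rfl
          omega
        · right; left
          refine ⟨e, ?_, fun _ _ w hw _ _ _ => o2.firstLeaf_le w hw⟩
          intro u hu v hv _ eu ev
          refine o1.le_lastLeaf hf1 u hu (Or.inr ?_)
          rintro rfl
          have := hflat (by omega) v hv
          omega
        · right; right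
          refine ⟨e, ?_, fun w hw _ _ _ _ _ => o2.firstLeaf_le w hw⟩
          intro u hu v hv _ eu ev
          refine o1.le_lastLeaf hf1 v hv (Or.inr ?_)
          rintro rfl
          omega
    · simp only [Set.mem_ofPred_eq]
      rintro a ha b hb a' ha' b' hb' hab hab'
      rcases hf5 a ha b hb hab with ⟨rfl, rfl⟩ | ⟨rfl, rfl⟩ <;>
      rcases hf5 a' ha' b' hb' hab' with ⟨rfl, rfl⟩ | ⟨rfl, rfl⟩ <;>
      · refine ⟨?_, ?_, ?_⟩ <;> intros <;> omega
  · intro w hw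
    rcases mem_snoc.1 hw with hw | hw
    exacts [h.ge w hw, h'.ge w hw]
  · intro hfst w hw e
    rcases mem_snoc.1 hw with hw | hw
    · exact hfst w hw e
    · exact (o3 _ A.root_mem _ hw).le

end Draw

/-! ### Inductive construction of drawings with prescribed leaf heights -/

section Exists

variable {G : SimpleGraph V} {x : V → ℤ} {v : V} {c A X : PlaneTree V} {j α β α' β' : ℤ}

theorem exists_glue (l l' : List V) (hd : ∀ a ∈ l, ∀ b ∈ l', x a < x b) (lv lv' : V → ℤ) :
    ∃ μ : V → ℤ, (∀ w ∈ l, μ w = lv w) ∧ ∀ w ∈ l', μ w = lv' w := by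
  classical
  refine ⟨fun w => if w ∈ l then lv w else lv' w, fun w hw => if_pos hw, fun w hw => if_neg ?_⟩
  intro hw'
  exact (hd w hw' w hw).false

/-- There is a drawing with the root last on its level. -/
def DrawsLeft (G : SimpleGraph V) (x : V → ℤ) (A : PlaneTree V) (j α β : ℤ) : Prop :=
  ∃ lv, A.Drawn G x lv j α β ∧ A.RootLast x lv j ∧ (β = 0 → ∀ w ∈ A.verts, lv w = j)

/-- There is a drawing with the root first on its level. -/
def DrawsRight (G : SimpleGraph V) (x : V → ℤ) (A : PlaneTree V) (j α β : ℤ) : Prop :=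
  ∃ lv, A.Drawn G x lv j α β ∧ A.RootFirst x lv j

/-- There is a drawing with the root alone on its level. -/
def DrawsAlone (G : SimpleGraph V) (x : V → ℤ) (A : PlaneTree V) (j α β : ℤ) : Prop :=
  ∃ lv, A.Drawn G x lv j α β ∧ A.RootLast x lv j ∧ A.RootFirst x lv j

/-- There is a drawing with the given levels of root, first leaf and last leaf. -/
def Draws (G : SimpleGraph V) (x : V → ℤ) (A : PlaneTree V) (j α β : ℤ) : Prop :=
  ∃ lv, A.Drawn G x lv j α β

theorem draws_leaf (v : V) (j : ℤ) : (leaf v).Draws G x j 0 0 := ⟨fun _ => j, drawn_leaf rfl⟩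

theorem drawsLeft_leaf (v : V) (j : ℤ) : (leaf v).DrawsLeft G x j 0 0 :=
  ⟨fun _ => j, drawn_leaf rfl, by simp [RootLast, verts, root], by simp⟩

theorem drawsRight_leaf (v : V) (j : ℤ) : (leaf v).DrawsRight G x j 0 0 :=
  ⟨fun _ => j, drawn_leaf rfl, by simp [RootFirst, verts, root]⟩

theorem DrawsAlone.drawsRight (h : A.DrawsAlone G x j α β) : A.DrawsRight G x j α β :=
  let ⟨lv, h1, _, h3⟩ := h
  ⟨lv, h1, h3⟩

theorem DrawsRight.draws (h : A.DrawsRight G x j α β) : A.Draws G x j α β :=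
  let ⟨lv, h1, _⟩ := h
  ⟨lv, h1⟩

theorem DrawsLeft.draws (h : A.DrawsLeft G x j α β) : A.Draws G x j α β :=
  let ⟨lv, h1, _⟩ := h
  ⟨lv, h1⟩

theorem DrawsLeft.single (h : c.DrawsLeft G x j α β) (hf : (single v c).Fits G)
    (ho : (single v c).Ordered x) : (single v c).DrawsLeft G x j α β := by
  obtain ⟨lv, h1, h2, h3⟩ := h
  obtain ⟨μ, m1, m2⟩ := exists_glue c.verts [v] (by simpa using (ordered_single.1 ho).2)
    lv (fun _ => j)
  obtain ⟨k1, k2⟩ := (h1.congr m1).single_flat (h2.congr m1) hf ho (m2 v (by simp))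
  refine ⟨μ, k1, k2, fun hb w hw => ?_⟩
  rcases mem_single.1 hw with hw | rfl
  · rw [m1 w hw, h3 hb w hw]
  · exact m2 _ (by simp)

theorem Draws.single (h : c.Draws G x (j + 1) α β) (hf : (single v c).Fits G)
    (ho : (single v c).Ordered x) : (single v c).DrawsAlone G x j (1 + α) (1 + β) := by
  obtain ⟨lv, h1⟩ := h
  obtain ⟨μ, m1, m2⟩ := exists_glue c.verts [v] (by simpa using (ordered_single.1 ho).2)
    lv (fun _ => j)
  exact ⟨μ, (h1.congr m1).single_up hf ho (m2 v (by simp))⟩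

theorem DrawsAlone.drawsLeft (h : A.DrawsAlone G x j α β) (hβ : 1 ≤ β) :
    A.DrawsLeft G x j α β := by
  obtain ⟨lv, h1, h2, h3⟩ := h
  exact ⟨lv, h1, h2, by omega⟩

theorem DrawsLeft.snoc_up (h : A.DrawsLeft G x j α β) (h' : X.Draws G x (j + 1) α' β')
    (hf : (snoc A X).Fits G) (ho : (snoc A X).Ordered x) (h1 : β ≤ α' + 2) (h2 : α' ≤ β) :
    (snoc A X).DrawsLeft G x j α (1 + β') := by
  obtain ⟨lv, a1, a2, a3⟩ := h
  obtain ⟨lv', b1⟩ := h'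
  obtain ⟨μ, m1, m2⟩ := exists_glue A.verts X.verts (ordered_snoc.1 ho).2.2 lv lv'
  have hb := b1.last_nonneg
  obtain ⟨k1, k2, -⟩ := (a1.congr m1).snoc_up (a2.congr m1)
    (fun hb w hw => by rw [m1 w hw, a3 hb w hw]) (b1.congr m2) hf ho h1 h2
  exact ⟨μ, k1, k2, by omega⟩

theorem DrawsAlone.snoc_up (h : A.DrawsAlone G x j α β) (hβ : 1 ≤ β)
    (h' : X.Draws G x (j + 1) α' β')
    (hf : (snoc A X).Fits G) (ho : (snoc A X).Ordered x) (h1 : β ≤ α' + 2) (h2 : α' ≤ β) :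
    (snoc A X).DrawsAlone G x j α (1 + β') := by
  obtain ⟨lv, a1, a2, a3⟩ := h
  obtain ⟨lv', b1⟩ := h'
  obtain ⟨μ, m1, m2⟩ := exists_glue A.verts X.verts (ordered_snoc.1 ho).2.2 lv lv'
  obtain ⟨k1, k2, k3⟩ := (a1.congr m1).snoc_up (a2.congr m1) (by omega) (b1.congr m2) hf ho h1 h2
  exact ⟨μ, k1, k2, k3 (a3.congr m1)⟩

theorem DrawsLeft.snoc_flat (h : A.DrawsLeft G x j α β) (h' : X.DrawsRight G x j α' β')
    (hf : (snoc A X).Fits G) (ho : (snoc A X).Ordered x) (h1 : β ≤ α' + 1) (h2 : α' ≤ β + 1)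
    (h0 : 1 ≤ β ∨ 1 ≤ α') : (snoc A X).Draws G x j α β' := by
  obtain ⟨lv, a1, a2, a3⟩ := h
  obtain ⟨lv', b1, b2⟩ := h'
  obtain ⟨μ, m1, m2⟩ := exists_glue A.verts X.verts (ordered_snoc.1 ho).2.2 lv lv'
  obtain ⟨k1, -⟩ := (a1.congr m1).snoc_flat (a2.congr m1)
    (fun hb w hw => by rw [m1 w hw, a3 hb w hw]) (b1.congr m2) (b2.congr m2) hf ho h1 h2 h0
  exact ⟨μ, k1⟩

theorem DrawsAlone.snoc_flat (h : A.DrawsAlone G x j α β) (hβ : 1 ≤ β)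
    (h' : X.DrawsRight G x j α' β')
    (hf : (snoc A X).Fits G) (ho : (snoc A X).Ordered x) (h1 : β ≤ α' + 1) (h2 : α' ≤ β + 1) :
    (snoc A X).DrawsRight G x j α β' := by
  obtain ⟨lv, a1, a2, a3⟩ := h
  obtain ⟨lv', b1, b2⟩ := h'
  obtain ⟨μ, m1, m2⟩ := exists_glue A.verts X.verts (ordered_snoc.1 ho).2.2 lv lv'
  obtain ⟨k1, k2⟩ := (a1.congr m1).snoc_flat (a2.congr m1) (by omega) (b1.congr m2) (b2.congr m2)
    hf ho h1 h2 (Or.inl hβ)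
  exact ⟨μ, k1, k2 (a3.congr m1)⟩

theorem Complete.branching_or (h : A.Complete) : A.Branching ∨ ∃ v, A = leaf v := by
  cases A with
  | leaf v => exact Or.inr ⟨v, rfl⟩
  | single v c => exact h.elim
  | snoc A X => exact Or.inl trivial

/-- For each of the two choices `γ = 0, 1`, a plane tree can be drawn in all ways needed to compose
drawings, such that a branching subtree has its first leaf at height `γ` and its last leaf at height
`1 - γ` above its root. -/
theorem exists_drawings (γ : ℤ) (hγ : γ = 0 ∨ γ = 1) (A : PlaneTree V) (hf : A.Fits G)
    (ho : A.Ordered x) (j : ℤ) :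
    (A.Branching → ∃ β, γ ≤ β ∧ β ≤ 2 - γ ∧ ((∃ v l, A = single v (leaf l)) ∨ 1 ≤ β) ∧
      A.DrawsLeft G x j γ β) ∧
    (A.Branching → ∃ α β, 1 ≤ α ∧ α ≤ 1 + γ ∧ 1 ≤ β ∧ β ≤ 2 - γ ∧ A.DrawsAlone G x j α β) ∧
    (A.Complete → ∃ α β, α ≤ γ ∧ β ≤ 1 - γ ∧ A.Draws G x j α β) ∧
    (A.Complete → A.Branching → ∃ α, 1 ≤ α ∧ α ≤ 1 + γ ∧ A.DrawsRight G x j α (1 - γ)) := by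
  -- The value `γ` stays fixed. Two consecutive branches drawn one level up then have leaves at
  -- heights at most `2 - γ` and `1 + γ`, within reach of one edge. The left and alone variants
  -- serve as initial parts `A` in `snoc A X`, the other two as last branches `X`.
  induction A generalizing j with
  | leaf v =>
    exact ⟨fun h => h.elim, fun h => h.elim,
      fun _ => ⟨0, 0, by omega, by omega, draws_leaf v j⟩, fun _ h => h.elim⟩
  | single v c ih =>
    have ih := ih hf.1 (ordered_single.1 ho).1
    refine ⟨fun _ => ?_, fun _ => ?_, fun h => h.elim, fun h => h.elim⟩
    · rcases hf.2.1.branching_or with hb | ⟨l, rfl⟩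
      · obtain ⟨β, h1, h2, h3, h4⟩ := (ih j).1 hb
        refine ⟨β, h1, h2, Or.inr ?_, h4.single hf ho⟩
        rcases h3 with ⟨v', l, rfl⟩ | h3
        · exact hf.2.1.elim
        · exact h3
      · rcases hγ with rfl | rfl
        · exact ⟨0, by omega, by omega, Or.inl ⟨v, l, rfl⟩, (drawsLeft_leaf l j).single hf ho⟩
        · exact ⟨1, by omega, by omega, Or.inl ⟨v, l, rfl⟩,
            ((draws_leaf l (j + 1)).single hf ho).drawsLeft (by omega)⟩
    · obtain ⟨α, β, h1, h2, h3⟩ := (ih (j + 1)).2.2.1 hf.2.1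
      have h4 := h3.choose_spec.first_nonneg
      have h5 := h3.choose_spec.last_nonneg
      exact ⟨1 + α, 1 + β, by omega, by omega, by omega, by omega, h3.single hf ho⟩
  | snoc A X ihA ihX =>
    have hf' := hf
    obtain ⟨f1, f2, f3, f4, -⟩ := hf'
    obtain ⟨o1, o2, -⟩ := ordered_snoc.1 ho
    have ihA := ihA f1 o1
    have ihX := ihX f3 o2
    obtain ⟨βl, l1, l2, -, l3⟩ := (ihA j).1 f2
    obtain ⟨αr, βr, r1, r2, r3, r4, r5⟩ := (ihA j).2.1 f2
    -- The bounds `γ ≤ βl ≤ 2 - γ` and `0 ≤ αx ≤ γ` yield the inequalities required by `snoc_up`.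
    obtain ⟨αx, βx, x1, x2, x3⟩ := (ihX (j + 1)).2.2.1 f4
    have x4 := x3.choose_spec.first_nonneg
    have x5 := x3.choose_spec.last_nonneg
    -- The last leaf must end at height `1 - γ`. A branching last child does so on the level of the
    -- root; a leaf has to be one level up for `γ = 0` and on the root's level for `γ = 1`.
    have last : (∃ α', 1 ≤ α' ∧ α' ≤ 1 + γ ∧ X.DrawsRight G x j α' (1 - γ)) ∨
        (γ = 0 ∧ X.Draws G x (j + 1) 0 0) ∨ (γ = 1 ∧ X.DrawsRight G x j 0 0) := by
      rcases f4.branching_or with hb | ⟨w, rfl⟩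
      · exact Or.inl ((ihX j).2.2.2 f4 hb)
      · rcases hγ with rfl | rfl
        · exact Or.inr (Or.inl ⟨rfl, draws_leaf w _⟩)
        · exact Or.inr (Or.inr ⟨rfl, drawsRight_leaf w _⟩)
    refine ⟨fun _ => ?_, fun _ => ?_, fun _ => ⟨γ, 1 - γ, le_rfl, le_rfl, ?_⟩,
      fun _ _ => ⟨αr, r1, r2, ?_⟩⟩
    · exact ⟨1 + βx, by omega, by omega, Or.inr (by omega),
        l3.snoc_up x3 hf ho (by omega) (by omega)⟩
    · exact ⟨αr, 1 + βx, by omega, by omega, by omega, by omega,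
        r5.snoc_up r3 x3 hf ho (by omega) (by omega)⟩
    · rcases last with ⟨η, e1, e2, e3⟩ | ⟨rfl, e⟩ | ⟨rfl, e⟩
      · exact l3.snoc_flat e3 hf ho (by omega) (by omega) (by omega)
      · exact (l3.snoc_up e hf ho (by omega) (by omega)).draws
      · exact l3.snoc_flat e hf ho (by omega) (by omega) (by omega)
    · rcases last with ⟨η, e1, e2, e3⟩ | ⟨rfl, e⟩ | ⟨rfl, e⟩
      · exact r5.snoc_flat r3 e3 hf ho (by omega) (by omega)
      · exact (r5.snoc_up r3 e hf ho (by omega) (by omega)).drawsRight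
      · exact r5.snoc_flat r3 e hf ho (by omega) (by omega)

end Exists

end PlaneTree

/-! ### Halin graphs as plane trees: choice of the root and exclusion of `K₄` -/

namespace PlaneTree

variable {V : Type*} {G : SimpleGraph V} {x : V → ℤ} {v t a b p q : V} {A B X Y Z : PlaneTree V}
  {j : ℤ}

theorem drawsLeft_snoc_leaf (hf : (snoc B (leaf v)).Fits G) (ho : (snoc B (leaf v)).Ordered x)
    (j : ℤ) : (snoc B (leaf v)).DrawsLeft G x j 0 1 := by
  obtain ⟨β, h1, h2, -, h3⟩ :=
    (exists_drawings 0 (Or.inl rfl) B hf.1 (ordered_snoc.1 ho).1 j).1 hf.2.1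
  exact h3.snoc_up (draws_leaf v _) hf ho (by omega) (by omega)

/-- Here `B` uses `γ = 0`, which puts the first leaf at height `0`, and `Y` uses `γ = 1`, which
keeps its last leaf at its root's height. The excluded shape of `B` is the one for which `β = 0` is
possible, too low for a first leaf of `Y` at height `2`. -/
theorem drawsLeft_snoc (hf : (snoc B Y).Fits G) (ho : (snoc B Y).Ordered x)
    (hB : ∀ v l, B ≠ single v (leaf l)) (j : ℤ) : (snoc B Y).DrawsLeft G x j 0 1 := by
  obtain ⟨o1, o2, -⟩ := ordered_snoc.1 ho
  obtain ⟨β, h1, h2, h3, h4⟩ := (exists_drawings 0 (Or.inl rfl) B hf.1 o1 j).1 hf.2.1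
  obtain ⟨α', β', k1, k2, k3⟩ :=
    (exists_drawings 1 (Or.inr rfl) Y hf.2.2.1 o2 (j + 1)).2.2.1 hf.2.2.2.1
  have k4 := k3.choose_spec.first_nonneg
  have k5 := k3.choose_spec.last_nonneg
  have hβ : 1 ≤ β := by
    rcases h3 with ⟨v, l, h⟩ | h
    exacts [absurd h (hB v l), h]
  have := h4.snoc_up k3 hf ho (by omega) (by omega)
  rwa [show 1 + β' = 1 by omega] at this

theorem drawsRight_snoc (hf : (snoc B Y).Fits G) (ho : (snoc B Y).Ordered x)
    (hY : Y.Branching) (j : ℤ) : (snoc B Y).DrawsRight G x j 1 0 := by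
  obtain ⟨o1, o2, -⟩ := ordered_snoc.1 ho
  obtain ⟨α, β, h1, h2, h3, h4, h5⟩ := (exists_drawings 0 (Or.inl rfl) B hf.1 o1 j).2.1 hf.2.1
  obtain ⟨α', k1, k2, k3⟩ :=
    (exists_drawings 1 (Or.inr rfl) Y hf.2.2.1 o2 j).2.2.2 hf.2.2.2.1 hY
  have := h5.snoc_flat h3 k3 hf ho (by omega) (by omega)
  rwa [show α = 1 by omega] at this

theorem drawsAlone_snoc (hf : (snoc B Y).Fits G) (ho : (snoc B Y).Ordered x) (j : ℤ) :
    (snoc B Y).DrawsAlone G x j 1 1 := by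
  obtain ⟨o1, o2, -⟩ := ordered_snoc.1 ho
  obtain ⟨α, β, h1, h2, h3, h4, h5⟩ := (exists_drawings 0 (Or.inl rfl) B hf.1 o1 j).2.1 hf.2.1
  obtain ⟨α', β', k1, k2, k3⟩ :=
    (exists_drawings 1 (Or.inr rfl) Y hf.2.2.1 o2 (j + 1)).2.2.1 hf.2.2.2.1
  have k4 := k3.choose_spec.first_nonneg
  have k5 := k3.choose_spec.last_nonneg
  have := h5.snoc_up h3 k3 hf ho (by omega) (by omega)
  rwa [show α = 1 by omega, show 1 + β' = 1 by omega] at this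

theorem draws_snoc_branching (hf : (snoc A X).Fits G) (ho : (snoc A X).Ordered x)
    (hA : ∀ v l, A ≠ single v (leaf l)) (hX : X.Branching) (j : ℤ) :
    (snoc A X).Draws G x j 0 0 := by
  obtain ⟨o1, o2, -⟩ := ordered_snoc.1 ho
  obtain ⟨β, h1, h2, h3, h4⟩ := (exists_drawings 0 (Or.inl rfl) A hf.1 o1 j).1 hf.2.1
  obtain ⟨α', k1, k2, k3⟩ :=
    (exists_drawings 1 (Or.inr rfl) X hf.2.2.1 o2 j).2.2.2 hf.2.2.2.1 hX
  have hβ : 1 ≤ β := by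
    rcases h3 with ⟨v, l, h⟩ | h
    exacts [absurd h (hA v l), h]
  exact h4.snoc_flat k3 hf ho (by omega) (by omega) (by omega)

theorem DrawsLeft.draws_snoc_leaf (h : A.DrawsLeft G x j 0 1) (hf : (snoc A (leaf v)).Fits G)
    (ho : (snoc A (leaf v)).Ordered x) : (snoc A (leaf v)).Draws G x j 0 0 :=
  h.snoc_flat (drawsRight_leaf v j) hf ho (by omega) (by omega) (by omega)

/-- The first branch is a leaf beside the root, so its height is `0` and the first leaf of `X` must
be at height exactly `1`: height `0` would send the path edge through the root. -/
theorem DrawsRight.draws_snoc_single (h : X.DrawsRight G x j 1 0)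
    (hf : (snoc (single p (leaf a)) X).Fits G) (ho : (snoc (single p (leaf a)) X).Ordered x) :
    (snoc (single p (leaf a)) X).Draws G x j 0 0 :=
  ((drawsLeft_leaf a j).single hf.1 (ordered_snoc.1 ho).1).snoc_flat h hf ho (by omega) (by omega)
    (by omega)

/-- The graph `G` consists of the plane tree `T`, rooted at the neighbour of the leaf `t`, and the
cycle through `t` and the leaves of `T`. -/
structure IsHalinAt (G : SimpleGraph V) (t : V) (T : PlaneTree V) : Prop where
  fits : T.Fits G
  complete : T.Complete
  branching : T.Branching
  nodup : (t :: T.verts).Nodup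
  mem : ∀ w, w = t ∨ w ∈ T.verts
  adj : ∀ w, G.Adj t w → w = T.root ∨ w = T.firstLeaf ∨ w = T.lastLeaf

/-- The vertex `t` is placed first in the horizontal order, alone on level `-1`. Its neighbours are
on level `0`, so its edges form a fan that crosses nothing. -/
theorem IsHalinAt.isKSWLP {T : PlaneTree V} (h : T.IsHalinAt G t)
    (hd : ∀ x : V → ℤ, T.Ordered x → T.Draws G x 0 0 0) : G.IsKSWLP 1 := by
  classical
  let x : V → ℤ := fun w => ((t :: T.verts).idxOf w : ℕ)
  have hx : Function.Injective x := by
    intro u v huv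
    have mem : ∀ w, w ∈ t :: T.verts := fun w => List.mem_cons.2 (h.mem w)
    refine (List.idxOf_inj (mem u)).1 ?_
    simpa [x] using huv
  have hpw : (t :: T.verts).Pairwise (fun a b => x a < x b) := by
    rw [List.pairwise_iff_getElem]
    intro i j hi hj hij
    simp only [x]
    rw [h.nodup.idxOf_getElem i hi, h.nodup.idxOf_getElem j hj]
    exact_mod_cast hij
  obtain ⟨htx, ho⟩ := List.pairwise_cons.1 hpw
  have htm : t ∉ T.verts := (List.nodup_cons.1 h.nodup).1
  obtain ⟨lv, hlv⟩ := hd x ho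
  let μ : V → ℤ := fun w => if w = t then -1 else lv w
  have m1 : ∀ w ∈ T.verts, μ w = lv w := fun w hw => if_neg (by rintro rfl; exact htm hw)
  have hμ := hlv.congr m1
  have ht : μ t = -1 := if_pos rfl
  have hz : ∀ w, G.Adj t w → μ w = 0 := by
    intro w hw
    rcases h.adj w hw with rfl | rfl | rfl
    exacts [hμ.root, hμ.firstLeaf, hμ.lastLeaf]
  refine SimpleGraph.LevelGood.isKSWLP (x := x) (lv := μ) ?_ hx
  have hS : (Set.univ : Set V) = {w | w ∈ [t]} ∪ {w | w ∈ T.verts} := by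
    ext w
    simpa using h.mem w
  rw [hS]
  refine (levelGood_singleton t).union hμ.good (by simpa using htx) ?_ ?_
  · simp only [List.mem_singleton, Set.mem_ofPred_eq]
    rintro _ rfl b hb hab
    have := hz b hab
    right; left
    refine ⟨by omega, by simp, fun u hu v _ _ e _ => ?_⟩
    have := hμ.ge u hu
    omega
  · simp only [List.mem_singleton, Set.mem_ofPred_eq]
    rintro a rfl b hb a' rfl b' hb' hab hab'
    have := hz b hab
    have := hz b' hab'
    omega

section Reroot

/-- In this and the next two lemmas the root `p` is kept, but another leaf adjacent to `p` is
removed and `t` becomes a child. This rotates the order of the branches at `p` into a shape with a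
`(0, 0)` drawing. -/
theorem IsHalinAt.reroot_of_snoc (h : (snoc (snoc (single p (leaf a)) X) (leaf b)).IsHalinAt G t) :
    G.IsKSWLP 1 := by
  obtain ⟨⟨⟨hf1, -, hf2, hf3, hf4⟩, -, -, -, hf5⟩, -, -, hn, hm, ha⟩ := h
  have irr : ∀ u, ¬ G.Adj u u := fun u => G.irrefl
  have hcomm := G.adj_comm
  have hr := X.root_mem
  have hfl := X.firstLeaf_mem
  have hll := X.lastLeaf_mem
  simp only [verts, root, firstLeaf, lastLeaf, Fits, List.mem_append, List.mem_cons,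
    List.nodup_cons, List.nodup_append, List.cons_append, List.nil_append,
    List.not_mem_nil] at hn hm ha hf1 hf4 hf5
  have h' : (snoc (snoc (single p X) (leaf b)) (leaf t)).IsHalinAt G a := by
    refine ⟨⟨⟨⟨hf2, hf3, ?_⟩, trivial, trivial, trivial, ?_⟩, trivial, trivial, trivial, ?_⟩,
      trivial, trivial, ?_, ?_, ?_⟩ <;>
    (try simp only [verts, root, firstLeaf, lastLeaf, List.mem_append, List.mem_cons,
      List.nodup_cons, List.nodup_append, List.append_assoc, List.cons_append, List.nil_append,
      List.not_mem_nil]) <;> grind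
  exact h'.isKSWLP fun x ho =>
    (drawsLeft_snoc_leaf h'.fits.1 (ordered_snoc.1 ho).1 0).draws_snoc_leaf h'.fits ho

theorem IsHalinAt.reroot_of_single_right
    (h : (snoc (single p (leaf a)) (snoc (single q X) (leaf b))).IsHalinAt G t) :
    G.IsKSWLP 1 := by
  obtain ⟨⟨hf1, -, ⟨⟨hf2, hf3, hf4⟩, -, -, -, hf5⟩, -, hf6⟩, -, -, hn, hm, ha⟩ := h
  have irr : ∀ u, ¬ G.Adj u u := fun u => G.irrefl
  have hcomm := G.adj_comm
  have hr := X.root_mem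
  have hfl := X.firstLeaf_mem
  have hll := X.lastLeaf_mem
  simp only [verts, root, firstLeaf, lastLeaf, Fits, List.mem_append, List.mem_cons,
    List.nodup_cons, List.nodup_append, List.append_assoc, List.cons_append, List.nil_append,
    List.not_mem_nil] at hn hm ha hf1 hf4 hf5 hf6
  have h' : (snoc (single p (snoc (single q X) (leaf b))) (leaf t)).IsHalinAt G a := by
    refine ⟨⟨⟨⟨⟨hf2, hf3, ?_⟩, trivial, trivial, trivial, ?_⟩, trivial, ?_⟩, trivial, trivial,
      trivial, ?_⟩, trivial, trivial, ?_, ?_, ?_⟩ <;>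
    (try simp only [verts, root, firstLeaf, lastLeaf, List.mem_append, List.mem_cons,
      List.nodup_cons, List.nodup_append, List.append_assoc, List.cons_append, List.nil_append,
      List.not_mem_nil]) <;> grind
  exact h'.isKSWLP fun x ho => ((drawsLeft_snoc_leaf h'.fits.1.1
    (ordered_single.1 (ordered_snoc.1 ho).1).1 0).single h'.fits.1
      (ordered_snoc.1 ho).1).draws_snoc_leaf h'.fits ho

theorem IsHalinAt.reroot_of_single_left
    (h : (snoc (single p (snoc (single q (leaf a)) X)) (leaf b)).IsHalinAt G t)
    (hX : X.Branching) : G.IsKSWLP 1 := by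
  obtain ⟨⟨⟨⟨hf1, -, hf2, hf3, hf4⟩, -, hf5⟩, -, -, -, hf6⟩, -, -, hn, hm, ha⟩ := h
  have irr : ∀ u, ¬ G.Adj u u := fun u => G.irrefl
  have hcomm := G.adj_comm
  have hr := X.root_mem
  have hfl := X.firstLeaf_mem
  have hll := X.lastLeaf_mem
  simp only [verts, root, firstLeaf, lastLeaf, Fits, List.mem_append, List.mem_cons,
    List.nodup_cons, List.nodup_append, List.append_assoc, List.cons_append, List.nil_append,
    List.not_mem_nil] at hn hm ha hf1 hf4 hf5 hf6
  have h' : (snoc (single p (leaf t)) (snoc (single q (leaf a)) X)).IsHalinAt G b := by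
    refine ⟨⟨⟨trivial, trivial, ?_⟩, trivial, ⟨⟨trivial, trivial, ?_⟩, trivial, hf2, hf3, ?_⟩,
      trivial, ?_⟩, trivial, trivial, ?_, ?_, ?_⟩ <;>
    (try simp only [verts, root, firstLeaf, lastLeaf, List.mem_cons,
      List.nodup_cons, List.cons_append, List.nil_append,
      List.not_mem_nil]) <;> grind
  exact h'.isKSWLP fun x ho =>
    (drawsRight_snoc h'.fits.2.2.1 (ordered_snoc.1 ho).2.1 hX 0).draws_snoc_single h'.fits ho

end Reroot

/-- There are only four vertices, and deleting any two of them leaves the other two connected, hence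
adjacent. -/
theorem IsHalinAt.nonempty_iso_top
    (h : (snoc (single p (leaf a)) (leaf b)).IsHalinAt G t) (hG : G.IsKConnected 3) :
    Nonempty (G ≃g (⊤ : SimpleGraph (Fin 4))) := by
  classical
  have hm : ∀ w, w ∈ [t, a, p, b] := by
    intro w
    have := h.mem w
    simpa [verts] using this
  have hn : [t, a, p, b].Nodup := by simpa [verts] using h.nodup
  let e : Fin 4 ≃ V := hn.getEquivOfForallMemList _ hm
  have hcard : Nat.card V = 4 := by rw [← Nat.card_congr e]; simp
  have : Finite V := Finite.of_equiv _ e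
  have : Fintype V := Fintype.ofFinite V
  have hadj : ∀ u v, u ≠ v → G.Adj u v := by
    intro u v huv
    have hc : ((Finset.univ \ {u, v} : Finset V)).card < 3 := by
      rw [Finset.card_sdiff_of_subset (Finset.subset_univ _), Finset.card_pair huv,
        Finset.card_univ, ← Nat.card_eq_fintype_card, hcard]
      norm_num
    have hcon := hG.2 _ hc
    have hu : u ∈ {w | w ∉ (Finset.univ \ {u, v} : Finset V)} := by simp
    have hv : v ∈ {w | w ∉ (Finset.univ \ {u, v} : Finset V)} := by simp
    have hne : (⟨u, hu⟩ : {w | w ∉ (Finset.univ \ {u, v} : Finset V)}) ≠ ⟨v, hv⟩ := by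
      simpa using huv
    have : Nontrivial {w | w ∉ (Finset.univ \ {u, v} : Finset V)} := ⟨_, _, hne⟩
    obtain ⟨⟨w, hw⟩, hadj⟩ := hcon.preconnected.exists_adj_of_nontrivial ⟨u, hu⟩
    have hadj : G.Adj u w := hadj
    have hw' : w = u ∨ w = v := by simpa [or_iff_not_imp_left] using hw
    rcases hw' with rfl | rfl
    · exact absurd hadj G.irrefl
    · exact hadj
  refine ⟨⟨e.symm, ?_⟩⟩
  intro u v
  simp only [SimpleGraph.top_adj, ne_eq, EmbeddingLike.apply_eq_iff_eq]
  exact ⟨hadj u v, fun h => h.ne⟩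

/-- If `A` is a root with one leaf, `X` must have a right drawing with heights `(1, 0)`. If `X` is a
leaf, `A` must have a left drawing with heights `(0, 1)`. Otherwise the drawings for `γ = 0` and `γ
= 1` fit together. The shapes that miss these demands are rerooted, apart from `K₄`. -/
theorem IsHalinAt.isKSWLP_of_snoc (h : (snoc A X).IsHalinAt G t) (hG : G.IsKConnected 3)
    (hK4 : ¬ Nonempty (G ≃g (⊤ : SimpleGraph (Fin 4)))) : G.IsKSWLP 1 := by
  have hf := h.fits
  by_cases hA : ∃ p a, A = PlaneTree.single p (leaf a)
  · obtain ⟨p, a, rfl⟩ := hA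
    cases X with
    | leaf b => exact absurd (h.nonempty_iso_top hG) hK4
    | single v c => exact hf.2.2.2.1.elim
    | snoc B Y =>
      have hfX := hf.2.2.1
      rcases hfX.2.2.2.1.branching_or with hY | ⟨y, rfl⟩
      · exact h.isKSWLP fun x ho =>
          (drawsRight_snoc hfX (ordered_snoc.1 ho).2.1 hY 0).draws_snoc_single hf ho
      · cases B with
        | leaf v => exact hfX.2.1.elim
        | single q c =>
          rcases hfX.1.2.1.branching_or with - | ⟨l, rfl⟩
          · exact h.reroot_of_single_right
          · refine h.isKSWLP fun x ho => DrawsRight.draws_snoc_single ?_ hf ho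
            have ho' := (ordered_snoc.1 ho).2.1
            exact ((draws_leaf l _).single hfX.1 (ordered_snoc.1 ho').1).snoc_flat (by omega)
              (drawsRight_leaf y 0) hfX ho' (by omega) (by omega)
        | snoc C Z =>
          refine h.isKSWLP fun x ho => DrawsRight.draws_snoc_single ?_ hf ho
          have ho' := (ordered_snoc.1 ho).2.1
          exact (drawsAlone_snoc hfX.1 (ordered_snoc.1 ho').1 0).snoc_flat (by omega)
            (drawsRight_leaf y 0) hfX ho' (by omega) (by omega)
  · push Not at hA
    rcases hf.2.2.2.1.branching_or with hX | ⟨b, rfl⟩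
    · exact h.isKSWLP fun x ho => draws_snoc_branching hf ho hA hX 0
    cases A with
    | leaf v => exact hf.2.1.elim
    | single p c =>
      cases c with
      | leaf a => exact absurd rfl (hA p a)
      | single v c => exact hf.1.2.1.elim
      | snoc B Y =>
        by_cases hB : ∃ q a, B = PlaneTree.single q (leaf a)
        · obtain ⟨q, a, rfl⟩ := hB
          rcases hf.1.1.2.2.2.1.branching_or with hY | ⟨y, rfl⟩
          · exact h.reroot_of_single_left hY
          · exact h.isKSWLP fun x ho => ((drawsLeft_snoc_leaf hf.1.1
              (ordered_single.1 (ordered_snoc.1 ho).1).1 0).single hf.1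
                (ordered_snoc.1 ho).1).draws_snoc_leaf hf ho
        · push Not at hB
          exact h.isKSWLP fun x ho => ((drawsLeft_snoc hf.1.1
              (ordered_single.1 (ordered_snoc.1 ho).1).1 hB 0).single hf.1
                (ordered_snoc.1 ho).1).draws_snoc_leaf hf ho
    | snoc B Y =>
      by_cases hB : ∃ q a, B = PlaneTree.single q (leaf a)
      · obtain ⟨q, a, rfl⟩ := hB
        rcases hf.1.2.2.2.1.branching_or with hY | ⟨y, rfl⟩
        · exact h.reroot_of_snoc
        · exact h.isKSWLP fun x ho => (drawsLeft_snoc_leaf hf.1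
            (ordered_snoc.1 ho).1 0).draws_snoc_leaf hf ho
      · push Not at hB
        exact h.isKSWLP fun x ho => (drawsLeft_snoc hf.1
            (ordered_snoc.1 ho).1 hB 0).draws_snoc_leaf hf ho

/-- A Halin graph other than `K₄` has a drawing on equispaced levels whose edges span at most two
levels. -/
theorem IsHalinAt.isKSWLP_of_ne_top {T : PlaneTree V} (h : T.IsHalinAt G t)
    (hG : G.IsKConnected 3) (hK4 : ¬ Nonempty (G ≃g (⊤ : SimpleGraph (Fin 4)))) :
    G.IsKSWLP 1 := by
  cases T with
  | leaf v => exact h.branching.elim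
  | single v c => exact h.complete.elim
  | snoc A X => exact h.isKSWLP_of_snoc hG hK4

end PlaneTree

/-! ### Sides of a tree edge -/

namespace SimpleGraph

variable {V : Type*} {T : SimpleGraph V} {u v w a b : V}

/-- The vertices that are joined to `v` without using the edge `uv`. -/
def side (T : SimpleGraph V) (u v : V) : Set V := {w | (T.deleteEdges {s(u, v)}).Reachable v w}

theorem mem_side_self (T : SimpleGraph V) (u v : V) : v ∈ T.side u v := Reachable.refl _

theorem mem_side_of_adj (ha : a ∈ T.side u v) (hab : T.Adj a b) (hne : s(a, b) ≠ s(u, v)) :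
    b ∈ T.side u v :=
  Reachable.trans ha (Adj.reachable (deleteEdges_adj.2 ⟨hab, by simpa using hne⟩))

/-- Induction along walks: a walk from `v` that leaves `Y` must do so across some edge other than
`uv`. -/
theorem side_subset {Y : Set V} (hv : v ∈ Y)
    (hY : ∀ a b, a ∈ T.side u v → a ∈ Y → T.Adj a b → s(a, b) ≠ s(u, v) → b ∈ Y) :
    T.side u v ⊆ Y := by
  rintro w ⟨p⟩
  by_contra hw
  obtain ⟨d, hd, h1, h2⟩ := p.exists_boundary_dart (T.side u v ∩ Y) ⟨mem_side_self T u v, hv⟩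
    (fun h => hw h.2)
  have hadj := deleteEdges_adj.1 d.adj
  have hne : s(d.fst, d.snd) ≠ s(u, v) := by simpa using hadj.2
  exact h2 ⟨mem_side_of_adj h1.1 hadj.1 hne, hY _ _ h1.1 h1.2 hadj.1 hne⟩

namespace IsAcyclic

theorem notMem_side (hT : T.IsAcyclic) (huv : T.Adj u v) : u ∉ T.side u v := fun h =>
  isBridge_iff.1 (isAcyclic_iff_forall_isBridge.1 hT (T.mem_edgeSet.2 huv)) h.symm

theorem eq_of_mem_side (hT : T.IsAcyclic) (huv : T.Adj u v) (ha : a ∈ T.side u v)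
    (hb : b ∉ T.side u v) (hab : T.Adj a b) : a = v ∧ b = u := by
  have : s(a, b) = s(u, v) := by
    by_contra hne
    exact hb (mem_side_of_adj ha hab hne)
  rcases Sym2.eq_iff.1 this with ⟨rfl, rfl⟩ | h
  · exact absurd ha (hT.notMem_side huv)
  · exact h

theorem disjoint_side (hT : T.IsAcyclic) (huv : T.Adj u v) (huw : T.Adj u w) (hne : v ≠ w) :
    Disjoint (T.side u v) (T.side u w) := by
  have : T.side u v ⊆ (T.side u w)ᶜ := by
    refine side_subset ?_ ?_
    · intro h
      exact hne (hT.eq_of_mem_side huw h (hT.notMem_side huw) huv.symm).1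
    · intro a b ha ha' hab hab' hb
      have := (hT.eq_of_mem_side huw hb ha' hab.symm).2
      exact hT.notMem_side huv (this ▸ ha)
  exact Set.disjoint_left.2 fun x hx hx' => this hx hx'

theorem side_subset_side (hT : T.IsAcyclic) (huv : T.Adj u v) (hvw : T.Adj v w) (hne : w ≠ u) :
    T.side v w ⊆ T.side u v := by
  refine side_subset ?_ ?_
  · refine mem_side_of_adj (mem_side_self T u v) hvw ?_
    intro h
    rcases Sym2.eq_iff.1 h with ⟨h, -⟩ | ⟨-, h⟩
    · exact huv.ne h.symm
    · exact hne h
  · intro a b ha ha' hab hab'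
    by_contra hb
    have := (hT.eq_of_mem_side huv ha' hb hab).1
    exact hT.notMem_side hvw (this ▸ ha)

theorem side_ssubset_side (hT : T.IsAcyclic) (huv : T.Adj u v) (hvw : T.Adj v w) (hne : w ≠ u) :
    T.side v w ⊂ T.side u v :=
  (Set.ssubset_iff_of_subset (hT.side_subset_side huv hvw hne)).2
    ⟨v, mem_side_self T u v, hT.notMem_side hvw⟩

end IsAcyclic

theorem eq_or_exists_mem_side (hw : w ∈ T.side u v) :
    w = v ∨ ∃ c, T.Adj v c ∧ c ≠ u ∧ w ∈ T.side v c := by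
  refine side_subset (T := T) (u := u) (v := v)
    (Y := {w | w = v ∨ ∃ c, T.Adj v c ∧ c ≠ u ∧ w ∈ T.side v c}) (Or.inl rfl) ?_ hw
  rintro a b - (rfl | ⟨c, h1, h2, h3⟩) hab hne
  · refine Or.inr ⟨b, hab, ?_, mem_side_self _ _ _⟩
    rintro rfl
    exact hne Sym2.eq_swap
  · by_cases he : s(a, b) = s(v, c)
    · rcases Sym2.eq_iff.1 he with ⟨-, rfl⟩ | ⟨-, rfl⟩
      · exact Or.inr ⟨b, h1, h2, mem_side_self _ _ _⟩
      · exact Or.inl rfl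
    · exact Or.inr ⟨c, h1, h2, mem_side_of_adj h3 hab he⟩

theorem Preconnected.mem_side_or (hT : T.Preconnected) (u v w : V) :
    w ∈ T.side u v ∨ w ∈ T.side v u := by
  by_contra hw
  obtain ⟨p⟩ := hT v w
  obtain ⟨d, -, h1, h2⟩ := p.exists_boundary_dart (T.side u v ∪ T.side v u)
    (Or.inl (mem_side_self _ _ _)) hw
  by_cases he : s(d.fst, d.snd) = s(u, v)
  · rcases Sym2.eq_iff.1 he with ⟨-, h⟩ | ⟨-, h⟩
    · exact h2 (Or.inl (h ▸ mem_side_self _ _ _))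
    · exact h2 (Or.inr (h ▸ mem_side_self _ _ _))
  · rcases h1 with h1 | h1
    · exact h2 (Or.inl (mem_side_of_adj h1 d.adj he))
    · exact h2 (Or.inr (mem_side_of_adj h1 d.adj (by rwa [Sym2.eq_swap (a := v)])))

theorem eq_of_neighborSet_ncard_eq_one (h : (T.neighborSet v).ncard = 1) (ha : T.Adj v a)
    (hb : T.Adj v b) : a = b := by
  obtain ⟨c, hc⟩ := Set.ncard_eq_one.1 h
  have ha' : a ∈ T.neighborSet v := ha
  have hb' : b ∈ T.neighborSet v := hb
  rw [hc] at ha' hb'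
  rw [Set.mem_singleton_iff.1 ha', Set.mem_singleton_iff.1 hb']

/-- Deleting fewer than `k` vertices of a `k`-connected graph leaves an edge between any two
parts of the remaining graph. -/
theorem IsKConnected.exists_adj {G : SimpleGraph V} {k : ℕ} (hG : G.IsKConnected k)
    (S : Finset V) (hS : S.card < k) (Y : Set V) (ha : a ∈ Y) (hb : b ∉ Y) (haS : a ∉ S)
    (hbS : b ∉ S) : ∃ c d, G.Adj c d ∧ c ∈ Y ∧ d ∉ Y ∧ c ∉ S ∧ d ∉ S := by
  obtain ⟨p⟩ := (hG.2 S hS).preconnected ⟨a, haS⟩ ⟨b, hbS⟩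
  obtain ⟨d, -, h1, h2⟩ := p.exists_boundary_dart {x | x.1 ∈ Y} ha hb
  exact ⟨d.fst.1, d.snd.1, d.adj, h1, h2, d.fst.2, d.snd.2⟩

end SimpleGraph

/-! ### Faces, outer edges and the rim -/

/-- A predicate that changes at one place of a cycle of a permutation changes at another place. -/
theorem Equiv.Perm.exists_ne_not_iff_apply {α : Type*} [Finite α] (f : Equiv.Perm α) (Q : α → Prop)
    (e : α) (h : ¬ (Q e ↔ Q (f e))) : ∃ e', f.SameCycle e e' ∧ e' ≠ e ∧ ¬ (Q e' ↔ Q (f e')) := by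
  by_contra! hall
  obtain ⟨n, hn⟩ : ∃ n : ℕ, (f ^ n) (f e) = e :=
    Equiv.Perm.SameCycle.exists_nat_pow_eq ((Equiv.Perm.sameCycle_apply_left).2 (.refl f e))
  have key : ∀ k : ℕ, Q ((f ^ k) (f e)) ↔ Q (f e) := by
    intro k
    induction k with
    | zero => rfl
    | succ k ih =>
      rw [pow_succ', Equiv.Perm.mul_apply, ← ih]
      refine (hall _ ?_ ?_).symm
      · exact (Equiv.Perm.sameCycle_pow_right).2 (Equiv.Perm.sameCycle_apply_right.2 (.refl f e))
      · intro he
        rw [he] at ih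
        exact h ih
  have := key n
  rw [hn] at this
  exact h this

namespace SimpleGraph

variable {V : Type*} {G : SimpleGraph V}

instance Dart.finite [Finite V] : Finite G.Dart := Finite.of_injective _ Dart.toProd_injective

namespace RotationSystem

variable (R : RotationSystem G)

theorem facePerm_apply (d : G.Dart) : R.facePerm d = R.rot d.symm := rfl

theorem facePerm_fst (d : G.Dart) : (R.facePerm d).fst = d.snd := R.rot_fst d.symm

theorem faceOf_eq_iff {d d' : G.Dart} : R.faceOf d = R.faceOf d' ↔ R.facePerm.SameCycle d d' :=
  Quotient.eq (r := Equiv.Perm.SameCycle.setoid R.facePerm)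

theorem faceOf_facePerm (d : G.Dart) : R.faceOf (R.facePerm d) = R.faceOf d :=
  R.faceOf_eq_iff.2 (Equiv.Perm.sameCycle_apply_left.2 (.refl _ _))

theorem faceOf_rot (d : G.Dart) : R.faceOf (R.rot d) = R.faceOf d.symm := by
  rw [← R.faceOf_facePerm d.symm, facePerm_apply, Dart.symm_symm]

theorem pow_rot_fst (d : G.Dart) (i : ℕ) : ((R.rot ^ i) d).fst = d.fst := by
  induction i with
  | zero => rfl
  | succ i ih => rw [pow_succ', Equiv.Perm.mul_apply, R.rot_fst, ih]

theorem exists_faceOf (g : R.Face) : ∃ d, R.faceOf d = g := Quotient.exists_rep g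

instance [Finite V] : Finite R.Face :=
  Finite.of_surjective R.faceOf R.exists_faceOf

end RotationSystem

namespace PlaneEmbedding

variable (P : PlaneEmbedding G)

/-- The dart lies on the boundary walk of the outer face. -/
def IsOuter (d : G.Dart) : Prop := P.faceOf d = P.outer

/-- The dart lies on the boundary walk of an inner face and its reversal on that of the outer
face. -/
def IsRim (d : G.Dart) : Prop := ¬ P.IsOuter d ∧ P.IsOuter d.symm

variable {P}

theorem edge_mem_outerEdges {d : G.Dart} :
    d.edge ∈ P.outerEdges ↔ P.IsOuter d ∨ P.IsOuter d.symm := by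
  constructor
  · rintro ⟨d', h, h'⟩
    rcases (dart_edge_eq_iff d' d).1 h' with rfl | rfl
    · exact Or.inl h
    · exact Or.inr h
  · rintro (h | h)
    · exact ⟨d, h, rfl⟩
    · exact ⟨d.symm, h, Dart.edge_symm d⟩

theorem characteristicTree_adj {d : G.Dart} :
    P.characteristicTree.Adj d.fst d.snd ↔ ¬ P.IsOuter d ∧ ¬ P.IsOuter d.symm := by
  rw [characteristicTree, deleteEdges_adj, ← not_or, ← edge_mem_outerEdges]
  exact ⟨fun h => h.2, fun h => ⟨d.adj, h⟩⟩

theorem adj_of_characteristicTree_adj {u v : V} (h : P.characteristicTree.Adj u v) : G.Adj u v :=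
  (deleteEdges_adj.1 h).1

theorem isOuter_rot_iff {d : G.Dart} : P.IsOuter (P.rot d) ↔ P.IsOuter d.symm := by
  rw [IsOuter, IsOuter, P.faceOf_rot]

theorem rim_edge_injective : Function.Injective (fun d : {d : G.Dart // P.IsRim d} =>
    (⟨d.1.edge, edge_mem_outerEdges.2 (Or.inr d.2.2)⟩ : P.outerEdges)) := by
  rintro ⟨d, hd⟩ ⟨d', hd'⟩ h
  rcases (dart_edge_eq_iff d d').1 (congrArg Subtype.val h) with rfl | rfl
  · rfl
  · exact absurd hd'.2 hd.1

/-- A set of faces that is closed under crossing the outer edges contains all faces if it is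
nonempty. -/
theorem face_induction [Finite V] (hT : P.characteristicTree.IsAcyclic) (F : P.Face → Prop)
    {d₀ : G.Dart} (h0 : F (P.faceOf d₀))
    (hF : ∀ d : G.Dart, d.edge ∈ P.outerEdges → (F (P.faceOf d) ↔ F (P.faceOf d.symm)))
    (d : G.Dart) : F (P.faceOf d) := by
  by_cases hex : ∃ d : G.Dart, ¬ (F (P.faceOf d) ↔ F (P.faceOf d.symm))
  · exfalso
    -- An edge across which `F` changes is a tree edge. Turning once around its far end, `F` must
    -- change at a second edge, whose side is strictly smaller; this contradicts minimality.
    obtain ⟨d, hd, hmin⟩ := exists_minimalFor_of_wellFoundedLT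
      (fun d : G.Dart => ¬ (F (P.faceOf d) ↔ F (P.faceOf d.symm)))
      (fun d => (P.characteristicTree.side d.fst d.snd).ncard) hex
    have hadj : ∀ d : G.Dart, ¬ (F (P.faceOf d) ↔ F (P.faceOf d.symm)) →
        P.characteristicTree.Adj d.fst d.snd := fun d hd =>
      deleteEdges_adj.2 ⟨d.adj, fun h => hd (hF d h)⟩
    obtain ⟨e, he1, he2, he3⟩ := P.rot.exists_ne_not_iff_apply (fun d => F (P.faceOf d)) d.symm
      (by rw [P.faceOf_rot, Dart.symm_symm, iff_comm]; exact hd)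
    rw [P.faceOf_rot] at he3
    have hfst : e.fst = d.snd := by
      obtain ⟨n, rfl⟩ := he1.exists_nat_pow_eq
      exact P.pow_rot_fst _ n
    have hsnd : e.snd ≠ d.fst := by
      intro h
      exact he2 (Dart.ext _ _ (Prod.ext hfst h))
    have he := hadj e he3
    rw [hfst] at he
    have hlt := Set.ncard_lt_ncard (hT.side_ssubset_side (hadj d hd) he hsnd) (Set.toFinite _)
    have := hmin he3 (by simpa [hfst] using hlt.le)
    simp only [hfst] at this
    omega
  · push Not at hex
    have hrot : ∀ d, F (P.faceOf (P.rot d)) ↔ F (P.faceOf d) := fun d => by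
      rw [P.faceOf_rot, hex d]
    have hfst : ∀ d d' : G.Dart, d.fst = d'.fst → F (P.faceOf d) → F (P.faceOf d') := by
      intro d d' h hd
      obtain ⟨n, rfl⟩ := (P.rot_cyclic d d' h).exists_nat_pow_eq
      clear h
      induction n with
      | zero => exact hd
      | succ n ih => rwa [pow_succ', Equiv.Perm.mul_apply, hrot]
    obtain ⟨p⟩ := P.connected.preconnected d₀.fst d.fst
    by_contra hd
    obtain ⟨e, -, h1, h2⟩ := p.exists_boundary_dart {v | ∀ d : G.Dart, d.fst = v → F (P.faceOf d)}
      (fun d hd => hfst d₀ d hd.symm h0) (fun h => hd (h d rfl))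
    exact h2 fun d hd => hfst e.symm d hd.symm ((hex e).1 (h1 e rfl))

section Tree

variable [Finite V]

/-- The complement of the tree is connected in the dual, so `face_induction` applies to the set
consisting of the outer face and the faces across an outer edge. -/
theorem exists_rim (hT : P.characteristicTree.IsTree) (g : P.Face) (hg : g ≠ P.outer) :
    ∃ d, P.IsRim d ∧ P.faceOf d = g := by
  obtain ⟨d₀, h0⟩ := P.exists_faceOf P.outer
  obtain ⟨e, rfl⟩ := P.exists_faceOf g
  have := face_induction hT.isAcyclic
    (fun g => g = P.outer ∨ ∃ d, P.IsOuter d ∧ P.faceOf d.symm = g) (Or.inl h0) (by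
      intro d hd
      have key : ∀ d : G.Dart, P.IsOuter d →
          ((P.faceOf d = P.outer ∨ ∃ d', P.IsOuter d' ∧ P.faceOf d'.symm = P.faceOf d) ↔
          (P.faceOf d.symm = P.outer ∨ ∃ d', P.IsOuter d' ∧ P.faceOf d'.symm = P.faceOf d.symm)) :=
        fun d hd => ⟨fun _ => Or.inr ⟨d, hd, rfl⟩, fun _ => Or.inl hd⟩
      rcases edge_mem_outerEdges.1 hd with h | h
      · exact key d h
      · have := key d.symm h
        rw [Dart.symm_symm] at this
        exact this.symm) e
  rcases this with h | ⟨d, h1, h2⟩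
  · exact absurd h hg
  · refine ⟨d.symm, ⟨?_, by rwa [Dart.symm_symm]⟩, h2⟩
    intro h
    exact hg (h2.symm.trans h)

/-- Euler's formula minus the edge count of the spanning tree. -/
theorem card_outerEdges (hT : P.characteristicTree.IsTree) :
    Nat.card P.outerEdges + 1 = Nat.card P.Face := by
  have h1 := P.euler
  have h2 := (isTree_iff_connected_and_card.1 hT).2
  have hsub : P.outerEdges ⊆ G.edgeSet := by
    rintro _ ⟨d, -, rfl⟩
    exact d.edge_mem
  have h3 : P.characteristicTree.edgeSet = G.edgeSet \ P.outerEdges := edgeSet_deleteEdges _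
  have h4 := Set.ncard_sdiff_add_ncard_of_subset hsub (Set.toFinite _)
  rw [h3] at h2
  simp only [Nat.card_coe_set_eq] at *
  omega

theorem card_inner (hT : P.characteristicTree.IsTree) :
    Nat.card {g : P.Face // g ≠ P.outer} = Nat.card P.outerEdges := by
  have h := card_outerEdges hT
  have h2 := Set.ncard_compl ({P.outer} : Set P.Face)
  rw [Set.ncard_singleton] at h2
  have : Nat.card {g : P.Face // g ≠ P.outer} = ({P.outer} : Set P.Face)ᶜ.ncard := rfl
  omega

theorem rim_face_surjective (hT : P.characteristicTree.IsTree) :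
    Function.Surjective
    (fun d : {d : G.Dart // P.IsRim d} =>
      (⟨P.faceOf d.1, d.2.1⟩ : {g : P.Face // g ≠ P.outer})) := by
  rintro ⟨g, hg⟩
  obtain ⟨d, h1, h2⟩ := exists_rim hT g hg
  exact ⟨⟨d, h1⟩, Subtype.ext h2⟩

/-- Every inner face has only one edge in common with the outer face. -/
theorem rim_unique (hT : P.characteristicTree.IsTree) {d d' : G.Dart}
    (hd : P.IsRim d) (hd' : P.IsRim d')
    (h : P.faceOf d = P.faceOf d') : d = d' := by
  -- Rim darts inject into the outer edges and surject onto the equally many inner faces, so both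
  -- maps are bijections.
  have hb := (rim_face_surjective hT).bijective_of_nat_card_le
    ((Nat.card_le_card_of_injective _ rim_edge_injective).trans (card_inner hT).ge)
  have := hb.1 (a₁ := ⟨d, hd⟩) (a₂ := ⟨d', hd'⟩) (Subtype.ext h)
  exact congrArg Subtype.val this

theorem IsOuter.isRim_symm (hT : P.characteristicTree.IsTree)
    {d : G.Dart} (hd : P.IsOuter d) : P.IsRim d.symm := by
  have hle : Nat.card P.outerEdges ≤ Nat.card {d : G.Dart // P.IsRim d} := by
    rw [← card_inner hT]
    exact Nat.card_le_card_of_surjective _ (rim_face_surjective hT)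
  obtain ⟨⟨e, he⟩, h⟩ := (rim_edge_injective.bijective_of_nat_card_le hle).2 ⟨d.edge, d, hd, rfl⟩
  rcases (dart_edge_eq_iff e d).1 (congrArg Subtype.val h) with rfl | rfl
  · exact absurd hd he.1
  · exact he

/-- A rim dart leaves a side of a tree edge if its face contains the tree edge directed into that
side, and enters it if its face contains the reversed tree edge. -/
theorem rim_crossing (hT : P.characteristicTree.IsTree) {e r : G.Dart}
    (he : P.characteristicTree.Adj e.fst e.snd) (hr : P.IsRim r) (χ : V → ℤ)
    (h1 : ∀ v ∈ P.characteristicTree.side e.fst e.snd, χ v = 1)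
    (h0 : ∀ v, v ∉ P.characteristicTree.side e.fst e.snd → χ v = 0)
    [Decidable (P.faceOf e = P.faceOf r)]
    [Decidable (P.faceOf e.symm = P.faceOf r)] :
    χ r.snd - χ r.fst + (if P.faceOf e = P.faceOf r then 1 else 0) -
      (if P.faceOf e.symm = P.faceOf r then 1 else 0) = 0 := by
  classical
  have : Fintype G.Dart := Fintype.ofFinite _
  have hA := hT.isAcyclic
  -- The boundary of a face is closed, so the increments of `χ` along it sum to zero.
  have hsum : ∑ d : G.Dart with P.faceOf d = P.faceOf r, χ d.snd =
      ∑ d : G.Dart with P.faceOf d = P.faceOf r, χ d.fst := by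
    refine Finset.sum_equiv P.facePerm ?_ ?_
    · intro d
      simp [P.faceOf_facePerm]
    · intro d _
      rw [P.facePerm_fst]
  rw [← sub_eq_zero, ← Finset.sum_sub_distrib] at hsum
  have hT' := characteristicTree_adj.1 he
  have hre : r ≠ e := by rintro rfl; exact hT'.2 hr.2
  have hre' : r ≠ e.symm := by
    rintro rfl
    have := hr.2
    rw [Dart.symm_symm] at this
    exact hT'.1 this
  -- All darts of this inner face other than `r` are tree darts, and among tree darts only `e` and
  -- `e.symm` change sides.
  have hterm : ∀ d : G.Dart, P.faceOf d = P.faceOf r → χ d.snd - χ d.fst =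
      (if d = r then χ r.snd - χ r.fst else 0) + (if d = e then 1 else 0) -
        (if d = e.symm then 1 else 0) := by
    intro d hd
    by_cases hdr : d = r
    · subst hdr
      simp [hre, hre']
    by_cases hde : d = e
    · subst hde
      rw [h1 _ (mem_side_self _ _ _), h0 _ (hA.notMem_side he)]
      simp [hdr, d.symm_ne.symm]
    by_cases hde' : d = e.symm
    · subst hde'
      have a1 := h1 e.snd (mem_side_self _ _ _)
      have a0 := h0 e.fst (hA.notMem_side he)
      simp [hdr, hde, a1, a0]
    rw [if_neg hdr, if_neg hde, if_neg hde']
    have hdo : ¬ P.IsOuter d := fun h => hr.1 (hd.symm.trans h)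
    have hds : ¬ P.IsOuter d.symm := fun h => hdr (rim_unique hT ⟨hdo, h⟩ hr hd)
    have hadj := characteristicTree_adj.2 ⟨hdo, hds⟩
    by_cases ha : d.fst ∈ P.characteristicTree.side e.fst e.snd <;>
    by_cases hb : d.snd ∈ P.characteristicTree.side e.fst e.snd
    · simp [h1 _ ha, h1 _ hb]
    · obtain ⟨q1, q2⟩ := hA.eq_of_mem_side he ha hb hadj
      exact absurd (Dart.ext _ _ (Prod.ext q1 q2)) hde'
    · obtain ⟨q1, q2⟩ := hA.eq_of_mem_side he hb ha hadj.symm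
      exact absurd (Dart.ext _ _ (Prod.ext q2 q1)) hde
    · simp [h0 _ ha, h0 _ hb]
  rw [Finset.sum_congr rfl (fun d hd => hterm d (by simpa using hd))] at hsum
  simp only [Finset.sum_sub_distrib, Finset.sum_add_distrib, Finset.sum_ite_eq', Finset.mem_filter,
    Finset.mem_univ, true_and, if_true] at hsum
  exact hsum

section Crossing

variable {e r : G.Dart}

/-- The two faces at a tree edge of a `3`-connected plane graph are distinct. -/
theorem faceOf_ne_faceOf_symm (hT : P.characteristicTree.IsTree) (hG : G.IsKConnected 3)
    (he : P.characteristicTree.Adj e.fst e.snd) : P.faceOf e ≠ P.faceOf e.symm := by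
  classical
  intro heq
  have hA := hT.isAcyclic
  set Y := P.characteristicTree.side e.fst e.snd with hY
  have hnot := hA.notMem_side he
  -- With the same face on both sides of `e` the two corrections cancel, so no rim edge crosses.
  -- Then `e` is a bridge, and deleting a suitable end of it disconnects the graph.
  have hrim : ∀ r, P.IsRim r → (r.fst ∈ Y ↔ r.snd ∈ Y) := by
    intro r hr
    have := rim_crossing hT he hr (fun v => if v ∈ Y then 1 else 0) (fun v hv => if_pos hv)
      (fun v hv => if_neg hv)
    rw [heq] at this
    by_cases h1 : r.fst ∈ Y <;> by_cases h2 : r.snd ∈ Y <;> simp_all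
  have hcross : ∀ c d, G.Adj c d → c ∈ Y → d ∉ Y → c = e.snd ∧ d = e.fst := by
    intro c d hcd hc hd
    let b : G.Dart := ⟨(c, d), hcd⟩
    by_cases ho : P.IsOuter b
    · exact absurd ((hrim _ (ho.isRim_symm hT)).2 hc) hd
    by_cases ho' : P.IsOuter b.symm
    · exact absurd ((hrim _ ⟨ho, ho'⟩).1 hc) hd
    exact hA.eq_of_mem_side he hc hd ((characteristicTree_adj (d := b)).2 ⟨ho, ho'⟩)
  obtain ⟨z, hz⟩ : ∃ z, z ∉ ({e.fst, e.snd} : Set V) := by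
    by_contra! hall
    have h1 : (Set.univ : Set V).ncard ≤ 2 := by
      rw [Set.eq_univ_of_forall hall |>.symm]
      exact (Set.ncard_insert_le _ _).trans (by simp)
    rw [Set.ncard_univ] at h1
    have := hG.1
    omega
  simp only [Set.mem_insert_iff, Set.mem_singleton_iff, not_or] at hz
  by_cases hzY : z ∈ Y
  · obtain ⟨c, d, h1, h2, h3, h4, -⟩ := hG.exists_adj {e.snd} (by simp) Y hzY hnot
      (by simpa using hz.2) (by simp)
    exact h4 (by simpa using (hcross c d h1 h2 h3).1)
  · obtain ⟨c, d, h1, h2, h3, -, h5⟩ := hG.exists_adj {e.fst} (by simp) Y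
      (mem_side_self _ _ _) hzY (by simp) (by simpa using hz.1)
    exact h5 (by simpa using (hcross c d h1 h2 h3).2)

theorem rim_leaves_iff (hT : P.characteristicTree.IsTree) (hG : G.IsKConnected 3)
    (he : P.characteristicTree.Adj e.fst e.snd) (hr : P.IsRim r) :
    (r.fst ∈ P.characteristicTree.side e.fst e.snd ∧
      r.snd ∉ P.characteristicTree.side e.fst e.snd) ↔ P.faceOf e = P.faceOf r := by
  classical
  have hne := faceOf_ne_faceOf_symm hT hG he
  have := rim_crossing hT he hr
    (fun v => if v ∈ P.characteristicTree.side e.fst e.snd then 1 else 0) (fun v hv => if_pos hv)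
    (fun v hv => if_neg hv)
  by_cases h1 : r.fst ∈ P.characteristicTree.side e.fst e.snd <;>
  by_cases h2 : r.snd ∈ P.characteristicTree.side e.fst e.snd <;>
  by_cases h3 : P.faceOf e = P.faceOf r <;> by_cases h4 : P.faceOf e.symm = P.faceOf r <;>
  simp_all

theorem rim_enters_iff (hT : P.characteristicTree.IsTree) (hG : G.IsKConnected 3)
    (he : P.characteristicTree.Adj e.fst e.snd) (hr : P.IsRim r) :
    (r.snd ∈ P.characteristicTree.side e.fst e.snd ∧
      r.fst ∉ P.characteristicTree.side e.fst e.snd) ↔ P.faceOf e.symm = P.faceOf r := by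
  classical
  have hne := faceOf_ne_faceOf_symm hT hG he
  have := rim_crossing hT he hr
    (fun v => if v ∈ P.characteristicTree.side e.fst e.snd then 1 else 0) (fun v hv => if_pos hv)
    (fun v hv => if_neg hv)
  by_cases h1 : r.fst ∈ P.characteristicTree.side e.fst e.snd <;>
  by_cases h2 : r.snd ∈ P.characteristicTree.side e.fst e.snd <;>
  by_cases h3 : P.faceOf e = P.faceOf r <;> by_cases h4 : P.faceOf e.symm = P.faceOf r <;>
  simp_all

end Crossing

end Tree

end PlaneEmbedding

end SimpleGraph

/-! ### From a Halin embedding to a plane tree -/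

namespace SimpleGraph

namespace PlaneEmbedding

variable {V : Type*} {G : SimpleGraph V} {P : PlaneEmbedding G} [Finite V] {d e : G.Dart}

/-- The edge that follows an edge of the outer face, in the order around a vertex, is a tree
edge. -/
theorem IsOuter.rot_adj (hT : P.characteristicTree.IsTree) (hd : P.IsOuter d) :
    P.characteristicTree.Adj (P.rot d).fst (P.rot d).snd := by
  have hr := hd.isRim_symm hT
  have h1 : ¬ P.IsOuter (P.rot d) := fun h => hr.1 (isOuter_rot_iff.1 h)
  refine characteristicTree_adj.2 ⟨h1, fun h2 => ?_⟩
  have := rim_unique hT ⟨h1, h2⟩ hr (P.faceOf_rot d)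
  have h3 := P.rot_fst d
  rw [this] at h3
  exact d.snd_ne_fst h3

/-- The internal vertices of the characteristic tree are not incident to the outer face. -/
theorem IsHalin.not_isOuter (hP : P.IsHalin)
    (hv : (P.characteristicTree.neighborSet d.fst).ncard ≠ 1) : ¬ P.IsOuter d := by
  classical
  intro hd
  have hT := hP.isTree
  have hA := hT.isAcyclic
  have hG := hP.three_connected
  have he := hd.rot_adj hT
  have hr := hd.isRim_symm hT
  have hfst := P.rot_fst d
  have hface := P.faceOf_rot d
  set e := P.rot d with he_def
  set Y := P.characteristicTree.side e.fst e.snd with hY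
  have hne := faceOf_ne_faceOf_symm hT hG he
  -- Only three edges join `Y` to its complement: `e`, the rim edge leaving `Y`, and the rim edge
  -- `r` entering it. The first two both end at `d.fst`, so `d.fst` and `r.snd` separate the graph.
  obtain ⟨hw, -⟩ : d.snd ∈ Y ∧ d.fst ∉ Y := (rim_leaves_iff hT hG he hr).2 hface
  have hv' : d.fst ∉ Y := hfst ▸ hA.notMem_side he
  obtain ⟨r, hr', hrf⟩ := exists_rim hT (P.faceOf e.symm) (characteristicTree_adj.1 he).2
  have hwe : d.snd ≠ e.snd := by
    intro h
    have : d = e := Dart.ext _ _ (Prod.ext hfst.symm h)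
    exact (characteristicTree_adj.1 he).1 (this ▸ hd)
  obtain ⟨y, hyY, hyr⟩ : ∃ y ∈ Y, y ≠ r.snd := by
    by_cases h : d.snd = r.snd
    · exact ⟨e.snd, mem_side_self _ _ _, fun h' => hwe (h.trans h'.symm)⟩
    · exact ⟨d.snd, hw, h⟩
  obtain ⟨hr1, -⟩ := (rim_enters_iff hT hG he hr').2 hrf.symm
  have hdeg := hP.three_le_degree _ hv
  obtain ⟨z, hz, hze⟩ : ∃ z ∈ P.characteristicTree.neighborSet d.fst, z ≠ e.snd :=
    Set.exists_ne_of_one_lt_ncard (by omega) _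
  have hzY : z ∉ Y := by
    intro h
    have := hA.eq_of_mem_side he h (hA.notMem_side he) (by rw [hfst]; exact hz.symm)
    exact hze this.1
  obtain ⟨a, b, hab, ha, hb, haS, hbS⟩ := hG.exists_adj {d.fst, r.snd}
    ((Finset.card_insert_le _ _).trans_lt (by simp)) Y hyY hzY
    (by
      simp only [Finset.mem_insert, Finset.mem_singleton, not_or]
      exact ⟨fun h => hv' (h ▸ hyY), hyr⟩)
    (by
      simp only [Finset.mem_insert, Finset.mem_singleton, not_or]
      exact ⟨Adj.ne' (G := P.characteristicTree) hz, fun h => hzY (h ▸ hr1)⟩)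
  simp only [Finset.mem_insert, Finset.mem_singleton, not_or] at haS hbS
  let c : G.Dart := ⟨(a, b), hab⟩
  by_cases ho : P.IsOuter c
  · have hc := ho.isRim_symm hT
    have := (rim_enters_iff hT hG he hc).1 ⟨ha, hb⟩
    have := rim_unique hT hr' hc (hrf.trans this)
    exact haS.2 (congrArg (fun d : G.Dart => d.snd) this).symm
  by_cases ho' : P.IsOuter c.symm
  · have hc : P.IsRim c := ⟨ho, ho'⟩
    have := (rim_leaves_iff hT hG he hc).1 ⟨ha, hb⟩
    have := rim_unique hT hr hc (hface.symm.trans this)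
    exact hbS.1 (congrArg (fun d : G.Dart => d.snd) this).symm
  · have := hA.eq_of_mem_side he ha hb ((characteristicTree_adj (d := c)).2 ⟨ho, ho'⟩)
    exact hbS.1 (this.2.trans hfst)

/-- All edges at an internal vertex of the characteristic tree are tree edges. -/
theorem IsHalin.adj_of_ncard_ne_one (hP : P.IsHalin)
    (hv : (P.characteristicTree.neighborSet d.fst).ncard ≠ 1) :
    P.characteristicTree.Adj d.fst d.snd := by
  refine characteristicTree_adj.2 ⟨hP.not_isOuter hv, fun h => ?_⟩
  have : (P.rot d).fst = d.fst := P.rot_fst d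
  exact hP.not_isOuter (d := P.rot d) (by rwa [this]) (isOuter_rot_iff.2 h)

theorem IsHalin.exists_isOuter_rot_eq (hP : P.IsHalin)
    (he : P.characteristicTree.Adj e.fst e.snd)
    (hv : (P.characteristicTree.neighborSet e.snd).ncard = 1) :
    ∃ d, P.IsOuter d ∧ d.fst = e.snd ∧ P.rot d = e.symm := by
  obtain ⟨d, hd, hdv⟩ := hP.leaf_mem_outer _ hv
  have h1 := IsOuter.rot_adj hP.isTree hd
  have h2 := P.rot_fst d
  refine ⟨d, hd, hdv, Dart.ext _ _ (Prod.ext (h2.trans hdv) ?_)⟩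
  rw [h2, hdv] at h1
  exact eq_of_neighborSet_ncard_eq_one hv h1 he.symm

/-- A leaf has only one tree edge. If the successor of `e.symm` were a tree dart it would be
`e.symm` itself, and the outer dart preceding `e.symm` would coincide with it. -/
theorem IsHalin.isRim_rot_symm (hP : P.IsHalin)
    (he : P.characteristicTree.Adj e.fst e.snd)
    (hv : (P.characteristicTree.neighborSet e.snd).ncard = 1) : P.IsRim (P.rot e.symm) := by
  obtain ⟨d, hd, hdv, hrot⟩ := hP.exists_isOuter_rot_eq he hv
  have h1 : ¬ P.IsOuter (P.rot e.symm) := by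
    rw [isOuter_rot_iff, Dart.symm_symm]
    exact (characteristicTree_adj.1 he).1
  refine ⟨h1, ?_⟩
  by_contra h2
  have h3 := characteristicTree_adj.2 ⟨h1, h2⟩
  have hfst : (P.rot e.symm).fst = e.snd := P.rot_fst _
  rw [hfst] at h3
  have h4 : P.rot e.symm = e.symm :=
    Dart.ext _ _ (Prod.ext hfst (eq_of_neighborSet_ncard_eq_one hv h3 he.symm))
  have h5 : d = e.symm := P.rot.injective (hrot.trans h4.symm)
  exact (characteristicTree_adj.1 he).2 (h5 ▸ hd)

/-- The tree darts leaving a vertex lie in distinct faces. -/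
theorem IsHalin.eq_of_faceOf_eq (hP : P.IsHalin) (hd : P.characteristicTree.Adj d.fst d.snd)
    (he : P.characteristicTree.Adj e.fst e.snd) (hfst : d.fst = e.fst)
    (hf : P.faceOf d = P.faceOf e) : d = e := by
  by_contra hne
  have hT := hP.isTree
  have hG := hP.three_connected
  obtain ⟨r, hr, hrf⟩ := exists_rim hT (P.faceOf d) (characteristicTree_adj.1 hd).1
  have h1 := ((rim_leaves_iff hT hG hd hr).2 hrf.symm).1
  have h2 := ((rim_leaves_iff hT hG he hr).2 (hf.symm.trans hrf.symm)).1
  rw [← hfst] at h2 he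
  refine Set.disjoint_left.1 (hT.isAcyclic.disjoint_side hd he ?_) h1 h2
  exact fun h => hne (Dart.ext _ _ (Prod.ext hfst h))

/-- The plane tree `X` is the part of the characteristic tree on the far side of `d`, with the
leaves in the order of the outer face. -/
structure IsBranch (P : PlaneEmbedding G) (d : G.Dart) (X : PlaneTree V) : Prop where
  fits : X.Fits G
  complete : X.Complete
  nodup : X.verts.Nodup
  mem : ∀ w, w ∈ X.verts ↔ w ∈ P.characteristicTree.side d.fst d.snd
  root : X.root = d.snd
  firstLeaf : ∀ r, P.IsRim r → P.faceOf r = P.faceOf d → r.fst = X.firstLeaf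
  lastLeaf : ∀ r, P.IsRim r → P.faceOf r = P.faceOf d.symm → r.snd = X.lastLeaf

theorem IsHalin.isBranch_leaf (hP : P.IsHalin) (hd : P.characteristicTree.Adj d.fst d.snd)
    (hv : (P.characteristicTree.neighborSet d.snd).ncard = 1) :
    P.IsBranch d (.leaf d.snd) := by
  refine ⟨trivial, trivial, by simp [PlaneTree.verts], ?_, rfl, ?_, ?_⟩
  · intro w
    rw [PlaneTree.verts, List.mem_singleton]
    constructor
    · rintro rfl
      exact mem_side_self _ _ _
    · intro h
      rcases eq_or_exists_mem_side h with h | ⟨c, h1, h2, -⟩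
      · exact h
      · exact absurd (eq_of_neighborSet_ncard_eq_one hv h1 hd.symm) h2
  · intro r hr hrf
    have h1 := hP.isRim_rot_symm hd hv
    have h2 := P.faceOf_rot d.symm
    rw [Dart.symm_symm] at h2
    rw [rim_unique hP.isTree hr h1 (hrf.trans h2.symm)]
    exact P.rot_fst _
  · intro r hr hrf
    obtain ⟨o, ho, hov, hrot⟩ := hP.exists_isOuter_rot_eq hd hv
    have h1 := ho.isRim_symm hP.isTree
    have h2 := P.faceOf_rot o
    rw [hrot] at h2
    rw [rim_unique hP.isTree hr h1 (hrf.trans h2)]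
    exact hov

/-- The plane tree consisting of the end of `d` and the branches at the first `k` darts that follow
`d` around its end. -/
theorem IsHalin.exists_partial_branch (hP : P.IsHalin)
    (hv : (P.characteristicTree.neighborSet d.snd).ncard ≠ 1)
    (ih : ∀ e : G.Dart, e.fst = d.snd → e ≠ d.symm → ∃ X, P.IsBranch e X) (k : ℕ)
    (hk : ∀ i, 1 ≤ i → i ≤ k + 1 → (P.rot ^ i) d.symm ≠ d.symm) :
    ∃ A : PlaneTree V, A.Fits G ∧ A.Branching ∧ (1 ≤ k → A.Complete) ∧ A.verts.Nodup ∧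
      (∀ w, w ∈ A.verts ↔ w = d.snd ∨ ∃ i, 1 ≤ i ∧ i ≤ k + 1 ∧
        w ∈ P.characteristicTree.side d.snd ((P.rot ^ i) d.symm).snd) ∧
      A.root = d.snd ∧
      (∀ r, P.IsRim r → P.faceOf r = P.faceOf d → r.fst = A.firstLeaf) ∧
      (∀ r, P.IsRim r → P.faceOf r = P.faceOf ((P.rot ^ (k + 1)) d.symm).symm →
        r.snd = A.lastLeaf) := by
  have hT := hP.isTree
  have hA := hT.isAcyclic
  have hG := hP.three_connected
  have hfst : ∀ i, ((P.rot ^ i) d.symm).fst = d.snd := fun i => P.pow_rot_fst _ i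
  have htree : ∀ e : G.Dart, e.fst = d.snd → P.characteristicTree.Adj e.fst e.snd := fun e he =>
    hP.adj_of_ncard_ne_one (by rwa [he])
  have hadj : ∀ i, P.characteristicTree.Adj d.snd ((P.rot ^ i) d.symm).snd := by
    intro i
    have := htree _ (hfst i)
    rwa [hfst] at this
  have hcancel : ∀ i j, i < j → (P.rot ^ i) d.symm = (P.rot ^ j) d.symm →
      (P.rot ^ (j - i)) d.symm = d.symm := by
    intro i j hij h
    apply (P.rot ^ i).injective
    rw [← Equiv.Perm.mul_apply, ← pow_add, h]
    congr 2
    omega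
  have hnot : ∀ i, d.snd ∉ P.characteristicTree.side d.snd ((P.rot ^ i) d.symm).snd :=
    fun i => hA.notMem_side (hadj i)
  induction k with
  | zero =>
    obtain ⟨c, hc⟩ := ih (P.rot d.symm) (hfst 1) (hk 1 le_rfl le_rfl)
    have hmem := hc.mem
    rw [show (P.rot d.symm).fst = d.snd from hfst 1] at hmem
    refine ⟨.single d.snd c, ⟨hc.fits, hc.complete, ?_⟩, trivial, by omega, ?_, ?_, rfl, ?_, ?_⟩
    · intro y hy hyd
      have h1 := htree ⟨(d.snd, y), hyd.symm⟩ rfl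
      rw [hc.root]
      exact (hA.eq_of_mem_side (hadj 1) ((hmem y).1 hy) (hnot 1) h1.symm).1
    · rw [PlaneTree.verts, List.nodup_append]
      refine ⟨hc.nodup, by simp, ?_⟩
      rintro a ha b hb rfl
      rw [List.mem_singleton.1 hb] at ha
      exact hnot 1 ((hmem _).1 ha)
    · intro w
      rw [PlaneTree.mem_single, hmem]
      constructor
      · rintro (h | h)
        · exact Or.inr ⟨1, le_rfl, le_rfl, h⟩
        · exact Or.inl h
      · rintro (h | ⟨i, h1, h2, h3⟩)
        · exact Or.inr h
        · obtain rfl : i = 1 := by omega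
          exact Or.inl h3
    · intro r hr hrf
      refine hc.firstLeaf r hr ?_
      rw [P.faceOf_rot, Dart.symm_symm, hrf]
    · exact hc.lastLeaf
  | succ k ihk =>
    obtain ⟨A, hf, hb, -, hn, hmem, hroot, hfl, hll⟩ :=
      ihk (fun i h1 h2 => hk i h1 (by omega))
    set e := (P.rot ^ (k + 1 + 1)) d.symm with he
    have hefst : e.fst = d.snd := hfst _
    have hes : e = P.rot ((P.rot ^ (k + 1)) d.symm) := by
      rw [he, pow_succ', Equiv.Perm.mul_apply]
    obtain ⟨X, hX⟩ := ih e hefst (hk _ (by omega) le_rfl)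
    have hXmem := hX.mem
    rw [hefst] at hXmem
    have hned : ∀ i, 1 ≤ i → i ≤ k + 1 → (P.rot ^ i) d.symm ≠ e := by
      intro i h1 h2 h
      exact hk _ (by omega) (by omega) (hcancel i (k + 1 + 1) (by omega) h)
    have hdisj : ∀ i, 1 ≤ i → i ≤ k + 1 →
        Disjoint (P.characteristicTree.side d.snd ((P.rot ^ i) d.symm).snd)
          (P.characteristicTree.side d.snd e.snd) := by
      intro i h1 h2
      refine hA.disjoint_side (hadj i) (hadj _) fun h => hned i h1 h2 ?_
      exact Dart.ext _ _ (Prod.ext ((hfst i).trans hefst.symm) h)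
    have hAX : ∀ a ∈ A.verts, a ∉ P.characteristicTree.side d.snd e.snd := by
      intro a ha
      rcases (hmem a).1 ha with rfl | ⟨i, h1, h2, h3⟩
      · exact hnot _
      · exact Set.disjoint_left.1 (hdisj i h1 h2) h3
    have headj : P.characteristicTree.Adj e.fst e.snd := htree e hefst
    refine ⟨.snoc A X, ⟨hf, hb, hX.fits, hX.complete, ?_⟩, trivial, fun _ => trivial, ?_, ?_, hroot,
      hfl, hX.lastLeaf⟩
    · intro a ha y hy hay
      have ha' := hAX a ha
      have hy' := (hXmem y).1 hy
      let b : G.Dart := ⟨(a, y), hay⟩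
      by_cases ho : P.IsOuter b
      · right
        have hr := ho.isRim_symm hT
        have hface := (rim_leaves_iff hT hG headj hr).1 (by rw [hefst]; exact ⟨hy', ha'⟩)
        refine ⟨hll b.symm hr ?_, hX.firstLeaf b.symm hr hface.symm⟩
        rw [← hface, hes, P.faceOf_rot]
      by_cases ho' : P.IsOuter b.symm
      -- A rim edge in the opposite direction would put `P.rot e` and the `i`-th dart in the same
      -- face, hence make them equal. A power of the rotation with exponent at most `k + 2` would
      -- then fix `d.symm`, contrary to `hk`.
      · exfalso
        have hr : P.IsRim b := ⟨ho, ho'⟩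
        rcases (hmem a).1 ha with had | ⟨i, h1, h2, h3⟩
        · exact (characteristicTree_adj.1 (htree b had)).2 ho'
        have hface := (rim_enters_iff hT hG headj hr).1 (by rw [hefst]; exact ⟨hy', ha'⟩)
        have hyi : y ∉ P.characteristicTree.side d.snd ((P.rot ^ i) d.symm).snd :=
          fun h => Set.disjoint_left.1 (hdisj i h1 h2) h hy'
        have hface' := (rim_leaves_iff hT hG (htree _ (hfst i)) hr).1
          (by rw [hfst]; exact ⟨h3, hyi⟩)
        have hrot : (P.rot e).fst = d.snd := (P.rot_fst e).trans hefst
        have heq := hP.eq_of_faceOf_eq (htree _ (hfst i)) (htree _ hrot)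
          ((hfst i).trans hrot.symm) (by rw [P.faceOf_rot, hface, hface'])
        rw [he, ← Equiv.Perm.mul_apply, ← pow_succ'] at heq
        exact hk _ (by omega) (by omega) (hcancel i (k + 1 + 1 + 1) (by omega) heq)
      · left
        have h1 := (characteristicTree_adj (d := b)).2 ⟨ho, ho'⟩
        have h2 := hA.eq_of_mem_side (hadj _) hy' ha' h1.symm
        exact ⟨h2.2.trans hroot.symm, h2.1.trans hX.root.symm⟩
    · rw [PlaneTree.verts, List.nodup_append]
      refine ⟨hn, hX.nodup, ?_⟩
      rintro a ha b hb rfl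
      exact hAX a ha ((hXmem a).1 hb)
    · intro w
      rw [PlaneTree.mem_snoc, hmem, hXmem]
      constructor
      · rintro ((h | ⟨i, h1, h2, h3⟩) | h)
        · exact Or.inl h
        · exact Or.inr ⟨i, h1, by omega, h3⟩
        · exact Or.inr ⟨k + 1 + 1, by omega, le_rfl, h⟩
      · rintro (h | ⟨i, h1, h2, h3⟩)
        · exact Or.inl (Or.inl h)
        · by_cases hi : i = k + 1 + 1
          · subst hi
            exact Or.inr h3
          · exact Or.inl (Or.inr ⟨i, h1, by omega, h3⟩)

theorem IsHalin.exists_isBranch (hP : P.IsHalin) (n : ℕ) (d : G.Dart)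
    (hd : P.characteristicTree.Adj d.fst d.snd)
    (hn : (P.characteristicTree.side d.fst d.snd).ncard = n) : ∃ X, P.IsBranch d X := by
  induction n using Nat.strong_induction_on generalizing d with
  | _ n ihn =>
  by_cases hv : (P.characteristicTree.neighborSet d.snd).ncard = 1
  · exact ⟨_, hP.isBranch_leaf hd hv⟩
  have hA := hP.isTree.isAcyclic
  have hfst : ∀ i, ((P.rot ^ i) d.symm).fst = d.snd := fun i => P.pow_rot_fst _ i
  have htree : ∀ e : G.Dart, e.fst = d.snd → P.characteristicTree.Adj e.fst e.snd := fun e he =>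
    hP.adj_of_ncard_ne_one (by rwa [he])
  have hsnd : ∀ e : G.Dart, e.fst = d.snd → e ≠ d.symm → e.snd ≠ d.fst :=
    fun e he hne h => hne (Dart.ext _ _ (Prod.ext he h))
  have ih : ∀ e : G.Dart, e.fst = d.snd → e ≠ d.symm → ∃ X, P.IsBranch e X := by
    intro e he hne
    have h1 := htree e he
    refine ihn _ ?_ e h1 rfl
    rw [← hn, he]
    exact Set.ncard_lt_ncard (hA.side_ssubset_side hd (he ▸ h1) (hsnd e he hne)) (Set.toFinite _)
  have hex : ∃ m, 0 < m ∧ (P.rot ^ m) d.symm = d.symm :=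
    ⟨orderOf P.rot, orderOf_pos _, by rw [pow_orderOf_eq_one]; rfl⟩
  classical
  obtain ⟨hm0, hm⟩ := Nat.find_spec hex
  have hmin : ∀ i, 1 ≤ i → i < Nat.find hex → (P.rot ^ i) d.symm ≠ d.symm := fun i h1 h2 h =>
    Nat.find_min hex h2 ⟨h1, h⟩
  set m := Nat.find hex with hm_def
  have hmod : ∀ i, (P.rot ^ (i % m)) d.symm = (P.rot ^ i) d.symm := by
    intro i
    have hmul : ∀ q, (P.rot ^ (m * q)) d.symm = d.symm := by
      intro q
      induction q with
      | zero => rfl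
      | succ q ihq => rw [mul_add, mul_one, pow_add, Equiv.Perm.mul_apply, hm, ihq]
    conv_rhs => rw [← Nat.mod_add_div i m, pow_add, Equiv.Perm.mul_apply, hmul]
  have hall : ∀ c, P.characteristicTree.Adj d.snd c →
      ∃ i < m, ((P.rot ^ i) d.symm).snd = c := by
    intro c hc
    obtain ⟨i, hi⟩ := (P.rot_cyclic d.symm ⟨(d.snd, c), adj_of_characteristicTree_adj hc⟩
      rfl).exists_nat_pow_eq
    exact ⟨i % m, Nat.mod_lt _ hm0, by rw [hmod, hi]⟩
  have hdeg := hP.three_le_degree _ hv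
  have hm3 : 3 ≤ m := by
    have hsub : P.characteristicTree.neighborSet d.snd ⊆
        ((Finset.range m).image fun i => ((P.rot ^ i) d.symm).snd : Finset V) := by
      intro c hc
      obtain ⟨i, h1, h2⟩ := hall c hc
      simp only [Finset.coe_image, Set.mem_image, Finset.coe_range, Set.mem_Iio]
      exact ⟨i, h1, h2⟩
    have h1 := Set.ncard_le_ncard hsub (Finset.finite_toSet _)
    rw [Set.ncard_coe_finset] at h1
    have h2 := Finset.card_image_le (s := Finset.range m) (f := fun i => ((P.rot ^ i) d.symm).snd)
    rw [Finset.card_range] at h2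
    omega
  -- The `m` darts at `d.snd` include `d.symm`, which leads to the parent; the other `m - 1` give
  -- the children, so `k + 1 = m - 1`. Since `m ≥ 3`, there are at least two and the tree is
  -- complete.
  obtain ⟨A, hf, -, hc, hnd, hmem, hroot, hfl, hll⟩ := hP.exists_partial_branch hv ih (m - 2)
    (fun i h1 h2 => hmin i h1 (by omega))
  refine ⟨A, hf, hc (by omega), hnd, ?_, hroot, hfl, ?_⟩
  · intro w
    rw [hmem]
    constructor
    · rintro (rfl | ⟨i, h1, h2, h3⟩)
      · exact mem_side_self _ _ _
      · have h4 := htree _ (hfst i)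
        rw [hfst] at h4
        exact hA.side_subset_side hd h4 (hsnd _ (hfst i) (hmin i h1 (by omega))) h3
    · intro hw
      rcases eq_or_exists_mem_side hw with h | ⟨c, h1, h2, h3⟩
      · exact Or.inl h
      · obtain ⟨i, h4, rfl⟩ := hall c h1
        refine Or.inr ⟨i, ?_, by omega, h3⟩
        rcases Nat.eq_zero_or_pos i with rfl | h
        · exact absurd rfl h2
        · exact h
  · intro r hr hrf
    refine hll r hr ?_
    rw [← P.faceOf_rot, ← Equiv.Perm.mul_apply, ← pow_succ', show m - 2 + 1 + 1 = m by omega, hm,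
      hrf]

/-- A Halin graph is composed of a plane tree and the cycle through its leaves. -/
theorem IsHalin.exists_isHalinAt (hP : P.IsHalin) : ∃ (t : V) (X : PlaneTree V),
    X.IsHalinAt G t := by
  have hT := hP.isTree
  have hA := hT.isAcyclic
  have hG := hP.three_connected
  obtain ⟨d, hd⟩ := P.exists_faceOf P.outer
  have hdeg : (P.characteristicTree.neighborSet d.fst).ncard = 1 := by
    by_contra h
    exact hP.not_isOuter h hd
  have he := IsOuter.rot_adj hT hd
  have hfst := P.rot_fst d
  set e := P.rot d with he_def
  set t := d.fst with ht
  obtain ⟨X, hX⟩ := hP.exists_isBranch _ e he rfl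
  have hXmem := hX.mem
  have he' := he
  rw [hfst] at hXmem he'
  have htX : t ∉ P.characteristicTree.side t e.snd := hA.notMem_side he'
  have hmem : ∀ w, w = t ∨ w ∈ X.verts := by
    intro w
    rw [hXmem]
    rcases hT.connected.preconnected.mem_side_or t e.snd w with h | h
    · exact Or.inr h
    · rcases eq_or_exists_mem_side h with h | ⟨c, h1, h2, -⟩
      · exact Or.inl h
      · exact absurd (eq_of_neighborSet_ncard_eq_one hdeg h1 he') h2
  refine ⟨t, X, hX.fits, hX.complete, ?_, ?_, hmem, ?_⟩
  · rcases hX.complete.branching_or with h | ⟨v, rfl⟩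
    · exact h
    · exfalso
      have h1 : (Set.univ : Set V).ncard ≤ 2 := by
        have : (Set.univ : Set V) ⊆ {t, v} := fun w _ => by
          simpa [PlaneTree.verts] using hmem w
        exact (Set.ncard_le_ncard this (Set.toFinite _)).trans
          ((Set.ncard_insert_le _ _).trans (by simp))
      rw [Set.ncard_univ] at h1
      have := hG.1
      omega
  · refine List.nodup_cons.2 ⟨?_, hX.nodup⟩
    rw [hXmem]
    exact htX
  · intro w hw
    have hwX : w ∈ P.characteristicTree.side t e.snd := by
      rcases hmem w with rfl | h
      · exact absurd hw G.irrefl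
      · exact (hXmem w).1 h
    let b : G.Dart := ⟨(t, w), hw⟩
    by_cases ho : P.IsOuter b
    · have hr := ho.isRim_symm hT
      have hface := (rim_leaves_iff hT hG he hr).1 (by rw [hfst]; exact ⟨hwX, htX⟩)
      exact Or.inr (Or.inl (hX.firstLeaf b.symm hr hface.symm))
    by_cases ho' : P.IsOuter b.symm
    · have hr : P.IsRim b := ⟨ho, ho'⟩
      have hface := (rim_enters_iff hT hG he hr).1 (by rw [hfst]; exact ⟨hwX, htX⟩)
      exact Or.inr (Or.inr (hX.lastLeaf b hr hface.symm))
    · have h1 := (characteristicTree_adj (d := b)).2 ⟨ho, ho'⟩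
      left
      rw [hX.root]
      exact (hA.eq_of_mem_side he' hwX htX h1.symm).1

end PlaneEmbedding

end SimpleGraph

theorem mainTheorem3 {V : Type*} [Finite V] (G : SimpleGraph V)
    (P : SimpleGraph.PlaneEmbedding G) (hHalin : P.IsHalin)
    (hK4 : ¬ Nonempty (G ≃g (⊤ : SimpleGraph (Fin 4)))) :
    G.IsKSWLP 1 := by
  obtain ⟨t, X, hX⟩ := hHalin.exists_isHalinAt
  exact hX.isKSWLP_of_ne_top hHalin.three_connected hK4
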